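/- Let $E$ be a complex vector space of dimension $3$ with dual space $E^*$. Let $SL(E)$ act on $\mathbb P(E\oplus E^*)\cong\mathbb P^5$ by $g\cdot[e+f]=[g e+f\circ g^{-1}]$, and let $\mathbb Q^4=\{[e+f] : e\in E,\ f\in E^*,\ f(e)=0\}$, an $SL(E)$-invariant smooth quadric. Then exactly one $SL(E)$-orbit $\mathcal O$ in $\mathbb Q^4$ is Zariski open in $\mathbb Q^4$. Write $F^\perp\subset E^*$ for the annihilator of a subspace $F\subset E$. (1) Let $B^1$ be a Borel subgroup (maximal closed connected solvable subgroup) of $SL(E)$. Then there are $B^1$-invariant subspaces $F_1\subset F_2$ of $E$, with $\dim F_i=i$, such that the smooth varieties which are Zariski closures of $B^1$-orbits in $\mathbb Q^4$ meeting $\mathcal O$ are exactly $$\mathbb Q^4,\quad \mathbb P(F_1\oplus F_1^\perp),\quad \mathbb P(F_2\oplus F_2^\perp),\quad \mathbb P(V_1\oplus W_1)\ \text{ with } V_1=F_1,\ W_1=F_2^\perp\subset V_1^\perp .$$ (2) A subset of $\mathbb P(E\oplus E^*)$ is a smooth Zariski closure of a $B^1$-orbit in $\mathbb Q^4$ meeting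 $\mathcal O$ for some Borel subgroup $B^1$ of $SL(E)$ if and only if it is one of $\mathbb Q^4$; $\mathbb P(F_1\oplus F_1^\perp)$ with $F_1\subset E$ a subspace of dimension $1$; $\mathbb P(F_2\oplus F_2^\perp)$ with $F_2\subset E$ a subspace of dimension $2$; $\mathbb P(V_1\oplus W_1)$ with $V_1\subset E$ a subspace of dimension $1$ and $W_1\subset V_1^\perp$ a subspace of dimension $1$. -/

import Mathlib

open scoped LinearAlgebra.Projectivization Topology

noncomputable section

namespace HorosphericalQuadric

section Zariski

variable (V : Type*) [AddCommGroup V] [Module ℂ V]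

/-- The value at `v` of a polynomial in linear forms on `V`. For finite dimensional `V` the
functions `polyEval V P` are exactly the polynomial functions on `V`, and those with `P`
homogeneous of degree `d` are exactly the homogeneous ones of degree `d`. -/
def polyEval (P : MvPolynomial (Module.Dual ℂ V) ℂ) (v : V) : ℂ :=
  MvPolynomial.eval (fun φ : Module.Dual ℂ V => φ v) P

/-- The Zariski topology of the affine space `V`: a basis is given by the non-vanishing loci of
polynomial functions. -/
abbrev affineZariski : TopologicalSpace V :=
  TopologicalSpace.generateFrom {U | ∃ P : MvPolynomial (Module.Dual ℂ V) ℂ,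
    U = {v | polyEval V P v ≠ 0}}

/-- The Zariski topology of the projective space `ℙ(V)` of lines in `V`: a basis is given by the
non-vanishing loci of homogeneous polynomials. -/
abbrev projZariski : TopologicalSpace (ℙ ℂ V) :=
  TopologicalSpace.generateFrom {U | ∃ (d : ℕ) (P : MvPolynomial (Module.Dual ℂ V) ℂ),
    P.IsHomogeneous d ∧ U = {x | polyEval V P x.rep ≠ 0}}

/-- The Zariski topology of `SL(V)`, as a subset of the affine space `End(V)`. -/
abbrev slZariski : TopologicalSpace (SpecialLinearGroup ℂ V) :=
  TopologicalSpace.induced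
    (fun g : SpecialLinearGroup ℂ V => ((g : V ≃ₗ[ℂ] V) : Module.End ℂ V))
    (affineZariski (Module.End ℂ V))

end Zariski

section Smooth

variable {V : Type*} [AddCommGroup V] [Module ℂ V]

/-- The affine chart `X ∩ {φ ≠ 0}` of `X ⊆ ℙ(V)`, realised in the affine hyperplane `{φ = 1}`
of `V`. -/
def affineChart (X : Set (ℙ ℂ V)) (φ : Module.Dual ℂ V) : Set V :=
  {v | φ v = 1 ∧ ∃ h : v ≠ 0, Projectivization.mk ℂ v h ∈ X}

/-- The coordinate ring of a (closed) subset `Z` of the affine space `V`: the `ℂ`-algebra of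
functions on `Z` which are restrictions of polynomial functions on `V`. -/
abbrev coordinateRing (Z : Set V) : Subalgebra ℂ (Z → ℂ) :=
  (MvPolynomial.aeval (R := ℂ) (fun (φ : Module.Dual ℂ V) (z : Z) => φ (z : V))).range

/-- A (closed) subset `X` of `ℙ(V)`, with its reduced structure, is smooth if it is covered by
affine charts whose coordinate rings are smooth `ℂ`-algebras. -/
def IsSmoothVariety (X : Set (ℙ ℂ V)) : Prop :=
  ∀ x ∈ X, ∃ φ : Module.Dual ℂ V, φ x.rep ≠ 0 ∧
    Algebra.Smooth ℂ (coordinateRing (affineChart X φ))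

/-- The projective subspace `ℙ(W)` of `ℙ(V)`. -/
def projSubspace (W : Submodule ℂ V) : Set (ℙ ℂ V) :=
  {x | x.submodule ≤ W}

end Smooth

section Group

variable {E : Type*} [AddCommGroup E] [Module ℂ E]

/-- Closed connected solvable subgroups of the algebraic group `SL(E)`. -/
def IsClosedConnectedSolvable (H : Subgroup (SpecialLinearGroup ℂ E)) : Prop :=
  IsClosed[slZariski E] (H : Set (SpecialLinearGroup ℂ E)) ∧
    @IsConnected _ (slZariski E) (H : Set (SpecialLinearGroup ℂ E)) ∧
    Group.IsSolvable H

/-- A Borel subgroup of `SL(E)` is a maximal closed connected solvable subgroup. -/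
def IsBorel (B : Subgroup (SpecialLinearGroup ℂ E)) : Prop :=
  Maximal IsClosedConnectedSolvable B

/-- The action of `g ∈ SL(E)` on `E ⊕ E*`, `(e, f) ↦ (g e, f ∘ g⁻¹)`. -/
def slAct (g : SpecialLinearGroup ℂ E) :
    (E × Module.Dual ℂ E) ≃ₗ[ℂ] (E × Module.Dual ℂ E) :=
  (g : E ≃ₗ[ℂ] E).prodCongr (g : E ≃ₗ[ℂ] E).symm.dualMap

/-- The induced action of `g ∈ SL(E)` on `ℙ(E ⊕ E*)`. -/
def slProjAct (g : SpecialLinearGroup ℂ E) (x : ℙ ℂ (E × Module.Dual ℂ E)) :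
    ℙ ℂ (E × Module.Dual ℂ E) :=
  x.map (slAct g).toLinearMap (slAct g).injective

/-- The orbit of `x ∈ ℙ(E ⊕ E*)` under a subgroup of `SL(E)`. -/
def orbitOf (H : Subgroup (SpecialLinearGroup ℂ E)) (x : ℙ ℂ (E × Module.Dual ℂ E)) :
    Set (ℙ ℂ (E × Module.Dual ℂ E)) :=
  {y | ∃ g ∈ H, y = slProjAct g x}

variable (E)

/-- The quadric `{[e + f] : ⟨e, f⟩ = 0}` in `ℙ(E ⊕ E*)`; it is `ℚ⁴` when `dim E = 3`. -/
def quadric : Set (ℙ ℂ (E × Module.Dual ℂ E)) :=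
  {x | x.rep.2 x.rep.1 = 0}

variable {E}

/-- `O` is an `SL(E)`-orbit in the quadric which is open in the quadric. -/
def IsOpenSLOrbit (O : Set (ℙ ℂ (E × Module.Dual ℂ E))) : Prop :=
  (∃ x ∈ quadric E, O = orbitOf ⊤ x) ∧
    ∃ U, IsOpen[projZariski (E × Module.Dual ℂ E)] U ∧ O = U ∩ quadric E

/-- The smooth Zariski closures of the `B`-orbits in the quadric which meet `O`. -/
def smoothOrbitClosures (B : Subgroup (SpecialLinearGroup ℂ E))
    (O : Set (ℙ ℂ (E × Module.Dual ℂ E))) : Set (Set (ℙ ℂ (E × Module.Dual ℂ E))) :=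
  {X | ∃ x ∈ quadric E, (orbitOf B x ∩ O).Nonempty ∧
    X = closure[projZariski (E × Module.Dual ℂ E)] (orbitOf B x) ∧ IsSmoothVariety X}

end Group

end HorosphericalQuadric

end

/-! Call `(e, f)` a nonzero pair if `e ≠ 0`, `f ≠ 0` and `f e = 0`. `SL(E)` acts transitively on
nonzero pairs, and a point of the quadric with `e = 0` or `f = 0` is a limit of such pairs along a
line. Hence the unique open orbit is `openOrbit` (`isOpenSLOrbit_iff`).

Borel subgroups are the stabilizers of full flags (`isBorel_iff`). By Lie–Kolchin
(`exists_common_eigenvector`) every connected solvable subgroup fixes a flag. Conversely, the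
stabilizer of a flag is closed, connected and solvable, and nested stabilizers belong to the same
flag. Connectedness enters Lie–Kolchin only through `FiniteValuedConst`, which passes to commutator
subgroups by a direct argument.

In a basis adapted to the flag, the Borel subgroup is upper triangular. It preserves the index `i`
of the last nonzero coordinate of `e` and the index `j` of the first nonzero coordinate of `f`, and
`f e = 0` forces `i ≠ j`. An explicit matrix shows that each of the six resulting cells is a single
orbit, and degenerating along lines shows that its closure is cut out by `e_k = 0` for `k > i`, `f_k
= 0` for `k < j`, and `f e = 0` (`IsAdapted.closure_orbitOf`).

With indices 0, 1, 2, the cell (2,0) gives the quadric. For (0,1), (0,2) and (1,2) the pairing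
vanishes identically on the linear conditions, so the closure is a projective subspace. For (1,0)
and (2,1) it is a cone over a quadric `x₁y₁ + x₂y₂ = 0`, singular at its vertex. Smoothness is
proved by exhibiting charts isomorphic to affine space, and singularity by the failure of
infinitesimal lifting (`not_smooth_coordinateRing`). -/

noncomputable section

namespace HorosphericalQuadric

/-! ### Regular functions on `SL(E)` and connectedness -/

section RegularFunctions

variable (E : Type*) [AddCommGroup E] [Module ℂ E]

/-- The algebra of functions on `SL(E)` generated by the matrix coefficients. -/
def regularFunctions : Subalgebra ℂ (SpecialLinearGroup ℂ E → ℂ) :=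
  Algebra.adjoin ℂ {f | ∃ (φ : Module.Dual ℂ E) (v : E), 
    f = fun g : SpecialLinearGroup ℂ E => φ ((g : E ≃ₗ[ℂ] E) v)}

variable {E}

theorem coeff_mem_regularFunctions (φ : Module.Dual ℂ E) (v : E) :
    (fun g : SpecialLinearGroup ℂ E => φ ((g : E ≃ₗ[ℂ] E) v)) ∈ regularFunctions E :=
  Algebra.subset_adjoin ⟨φ, v, rfl⟩

theorem const_mem_regularFunctions (c : ℂ) :
    (fun _ : SpecialLinearGroup ℂ E => c) ∈ regularFunctions E :=
  (regularFunctions E).algebraMap_mem c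

theorem sum_mem_regularFunctions {ι : Type*} (s : Finset ι)
    {f : ι → SpecialLinearGroup ℂ E → ℂ} (hf : ∀ i ∈ s, f i ∈ regularFunctions E) :
    (fun g => ∑ i ∈ s, f i g) ∈ regularFunctions E := by
  have := Subalgebra.sum_mem (regularFunctions E) hf
  convert this using 1
  ext g
  simp

theorem prod_mem_regularFunctions {ι : Type*} (s : Finset ι)
    {f : ι → SpecialLinearGroup ℂ E → ℂ} (hf : ∀ i ∈ s, f i ∈ regularFunctions E) :
    (fun g => ∏ i ∈ s, f i g) ∈ regularFunctions E := by
  have := Subalgebra.prod_mem (regularFunctions E) hf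
  convert this using 1
  ext g
  simp

theorem mul_mem_regularFunctions {f₁ f₂ : SpecialLinearGroup ℂ E → ℂ}
    (h₁ : f₁ ∈ regularFunctions E) (h₂ : f₂ ∈ regularFunctions E) :
    (fun g => f₁ g * f₂ g) ∈ regularFunctions E :=
  (regularFunctions E).mul_mem h₁ h₂

/-- A self-map of `SL(E)` is regular if it pulls back regular functions to regular functions. -/
def IsRegularMap (θ : SpecialLinearGroup ℂ E → SpecialLinearGroup ℂ E) : Prop :=
  ∀ f ∈ regularFunctions E, (fun g => f (θ g)) ∈ regularFunctions E

theorem isRegularMap_of_coeff {θ : SpecialLinearGroup ℂ E → SpecialLinearGroup ℂ E}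
    (h : ∀ (φ : Module.Dual ℂ E) (v : E),
      (fun g => φ ((θ g : E ≃ₗ[ℂ] E) v)) ∈ regularFunctions E) : IsRegularMap θ := by
  intro f hf
  induction hf using Algebra.adjoin_induction with
  | mem x hx =>
    obtain ⟨φ, v, rfl⟩ := hx
    exact h φ v
  | algebraMap r => exact const_mem_regularFunctions r
  | add x y _ _ hx hy => exact (regularFunctions E).add_mem hx hy
  | mul x y _ _ hx hy => exact (regularFunctions E).mul_mem hx hy

theorem IsRegularMap.id : IsRegularMap (fun g : SpecialLinearGroup ℂ E => g) := fun _ hf => hf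

theorem IsRegularMap.const (g₀ : SpecialLinearGroup ℂ E) : IsRegularMap (fun _ => g₀) :=
  fun f _ => const_mem_regularFunctions (f g₀)

theorem exists_polyEval_eq {f : SpecialLinearGroup ℂ E → ℂ} (hf : f ∈ regularFunctions E) :
    ∃ P : MvPolynomial (Module.Dual ℂ (Module.End ℂ E)) ℂ, ∀ g : SpecialLinearGroup ℂ E,
      f g = polyEval _ P ((g : E ≃ₗ[ℂ] E) : Module.End ℂ E) := by
  induction hf using Algebra.adjoin_induction with
  | mem x hx =>
    obtain ⟨φ, v, rfl⟩ := hx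
    exact ⟨MvPolynomial.X (φ.comp (LinearMap.applyₗ v)), fun g => by simp [polyEval]⟩
  | algebraMap r => exact ⟨MvPolynomial.C r, fun g => by simp [polyEval]⟩
  | add x y _ _ hx hy =>
    obtain ⟨P, hP⟩ := hx
    obtain ⟨Q, hQ⟩ := hy
    exact ⟨P + Q, fun g => by simp [polyEval, hP, hQ]⟩
  | mul x y _ _ hx hy =>
    obtain ⟨P, hP⟩ := hx
    obtain ⟨Q, hQ⟩ := hy
    exact ⟨P * Q, fun g => by simp [polyEval, hP, hQ]⟩

theorem isClosed_zeroLocus {f : SpecialLinearGroup ℂ E → ℂ} (hf : f ∈ regularFunctions E) :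
    IsClosed[slZariski E] {g | f g = 0} := by
  obtain ⟨P, hP⟩ := exists_polyEval_eq hf
  let := slZariski E
  rw [← isOpen_compl_iff]
  let := affineZariski (Module.End ℂ E)
  refine isOpen_induced_iff.mpr ⟨{v | polyEval _ P v ≠ 0},
    TopologicalSpace.isOpen_generateFrom_of_mem ⟨P, rfl⟩, ?_⟩
  ext g
  simp [hP]

/-- Regular functions with finitely many values on `H` are constant on `H`; this holds
if `H` is connected. -/
def FiniteValuedConst (H : Subgroup (SpecialLinearGroup ℂ E)) : Prop :=
  ∀ f ∈ regularFunctions E, (f '' (H : Set (SpecialLinearGroup ℂ E))).Finite →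
    ∀ g ∈ H, f g = f 1

/-- Level sets of a regular function are closed, so finitely many values would split `H` into two
disjoint closed pieces. -/
theorem finiteValuedConst_of_isConnected {H : Subgroup (SpecialLinearGroup ℂ E)}
    (hH : @IsConnected _ (slZariski E) (H : Set (SpecialLinearGroup ℂ E))) :
    FiniteValuedConst H := by
  intro f hf hfin g hg
  let := slZariski E
  have hcl : ∀ c : ℂ, IsClosed {g : SpecialLinearGroup ℂ E | f g = c} := by
    intro c
    have := isClosed_zeroLocus ((regularFunctions E).sub_mem hf (const_mem_regularFunctions c))
    simpa [sub_eq_zero] using this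
  by_contra hne
  set S := (f '' (H : Set (SpecialLinearGroup ℂ E))) \ {f 1}
  have hB : IsClosed (⋃ c ∈ S, {g : SpecialLinearGroup ℂ E | f g = c}) :=
    Set.Finite.isClosed_biUnion (hfin.subset Set.sdiff_subset) fun c _ => hcl c
  obtain ⟨x, -, hx1, hx2⟩ := isPreconnected_closed_iff.mp hH.isPreconnected _ _ (hcl (f 1)) hB
    (by
      intro x hx
      by_cases h : f x = f 1
      · exact Or.inl h
      · exact Or.inr (Set.mem_biUnion (x := f x) ⟨⟨x, hx, rfl⟩, h⟩ rfl))
    ⟨1, H.one_mem, rfl⟩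
    ⟨g, hg, Set.mem_biUnion (x := f g) ⟨⟨g, hg, rfl⟩, hne⟩ rfl⟩
  simp only [Set.mem_iUnion, Set.mem_ofPred_eq] at hx1 hx2
  obtain ⟨c, hc, hxc⟩ := hx2
  exact hc.2 (by rw [← hxc, hx1]; rfl)

variable [FiniteDimensional ℂ E]

theorem IsRegularMap.mul {θ₁ θ₂ : SpecialLinearGroup ℂ E → SpecialLinearGroup ℂ E}
    (h₁ : IsRegularMap θ₁) (h₂ : IsRegularMap θ₂) : IsRegularMap (fun g => θ₁ g * θ₂ g) := by
  refine isRegularMap_of_coeff fun φ v => ?_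
  let b := Module.finBasis ℂ E
  have key : ∀ g, φ (((θ₁ g * θ₂ g : SpecialLinearGroup ℂ E) : E ≃ₗ[ℂ] E) v) =
      ∑ i, b.coord i ((θ₂ g : E ≃ₗ[ℂ] E) v) * φ ((θ₁ g : E ≃ₗ[ℂ] E) (b i)) := by
    intro g
    have : ((θ₁ g * θ₂ g : SpecialLinearGroup ℂ E) : E ≃ₗ[ℂ] E) v
        = (θ₁ g : E ≃ₗ[ℂ] E) ((θ₂ g : E ≃ₗ[ℂ] E) v) := rfl
    rw [this]
    conv_lhs => rw [← b.sum_repr ((θ₂ g : E ≃ₗ[ℂ] E) v)]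
    simp only [map_sum, map_smul, smul_eq_mul, Module.Basis.coord_apply]
  simp_rw [key]
  exact sum_mem_regularFunctions _ fun i _ => mul_mem_regularFunctions
    (h₂ _ (coeff_mem_regularFunctions _ _)) (h₁ _ (coeff_mem_regularFunctions _ _))

/-- Since the determinant is 1, the inverse matrix is the adjugate, whose entries are polynomials in
the matrix coefficients. -/
theorem isRegularMap_inv : IsRegularMap (fun g : SpecialLinearGroup ℂ E => g⁻¹) := by
  refine isRegularMap_of_coeff fun φ v => ?_
  let b := Module.finBasis ℂ E
  have entry : ∀ i j, (fun g : SpecialLinearGroup ℂ E =>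
      b.coord i (((g⁻¹ : SpecialLinearGroup ℂ E) : E ≃ₗ[ℂ] E) (b j))) ∈ regularFunctions E := by
    intro i j
    have h : ∀ g : SpecialLinearGroup ℂ E,
        b.coord i (((g⁻¹ : SpecialLinearGroup ℂ E) : E ≃ₗ[ℂ] E) (b j)) =
        ∑ σ : Equiv.Perm (Fin _), (((Equiv.Perm.sign σ : ℤ) : ℂ)) *
          ∏ k, ((LinearMap.toMatrix b b (g : E →ₗ[ℂ] E)).updateRow j (Pi.single i 1)) (σ k) k := by
      intro g
      have h1 : ((Matrix.SpecialLinearGroup.toLin_equiv b).symm g⁻¹ : Matrix _ _ ℂ) i j =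
          ((((Matrix.SpecialLinearGroup.toLin_equiv b).symm g)⁻¹ :
            Matrix.SpecialLinearGroup _ ℂ) : Matrix _ _ ℂ) i j := by
        rw [map_inv]
      rw [Matrix.SpecialLinearGroup.coe_inv,
        Matrix.SpecialLinearGroup.toLin_equiv.symm_toLinearMap_eq,
        Matrix.SpecialLinearGroup.toLin_equiv.symm_toLinearMap_eq,
        LinearMap.toMatrix_apply, Matrix.adjugate_apply, Matrix.det_apply'] at h1
      exact h1
    simp_rw [h]
    refine sum_mem_regularFunctions _ fun σ _ => mul_mem_regularFunctions
      (const_mem_regularFunctions _) (prod_mem_regularFunctions _ fun k _ => ?_)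
    by_cases hk : σ k = j
    · simp only [Matrix.updateRow_apply, hk, if_true]
      exact const_mem_regularFunctions _
    · simp only [Matrix.updateRow_apply, hk, if_false, LinearMap.toMatrix_apply]
      exact coeff_mem_regularFunctions (b.coord _) _
  have key : ∀ g : SpecialLinearGroup ℂ E,
      φ (((g⁻¹ : SpecialLinearGroup ℂ E) : E ≃ₗ[ℂ] E) v) =
      ∑ i, ∑ j, (b.repr v j * φ (b i)) *
        b.coord i (((g⁻¹ : SpecialLinearGroup ℂ E) : E ≃ₗ[ℂ] E) (b j)) := by
    intro g
    conv_lhs => rw [← b.sum_repr v]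
    simp only [map_sum, map_smul, smul_eq_mul]
    rw [Finset.sum_comm]
    refine Finset.sum_congr rfl fun j _ => ?_
    conv_lhs => rw [← b.sum_repr (((g⁻¹ : SpecialLinearGroup ℂ E) : E ≃ₗ[ℂ] E) (b j))]
    simp only [map_sum, map_smul, smul_eq_mul, Finset.mul_sum, Module.Basis.coord_apply]
    exact Finset.sum_congr rfl fun i _ => by ring
  simp_rw [key]
  exact sum_mem_regularFunctions _ fun i _ => sum_mem_regularFunctions _ fun j _ =>
    mul_mem_regularFunctions (const_mem_regularFunctions _) (entry i j)

theorem IsRegularMap.inv {θ : SpecialLinearGroup ℂ E → SpecialLinearGroup ℂ E}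
    (h : IsRegularMap θ) : IsRegularMap (fun g => (θ g)⁻¹) :=
  fun _ hf => h _ (isRegularMap_inv _ hf)

/-- For fixed `x` in the commutator subgroup and `a ∈ H`, the map sending `b` to `x * (a * b * a⁻¹ *
b⁻¹)` is regular and sends `H` into the commutator subgroup. A finite-valued `f` is therefore
constant along it, with value `f x` taken at `b = 1`. So `f` is unchanged by right multiplication by
each generator. -/
theorem FiniteValuedConst.commutator {H : Subgroup (SpecialLinearGroup ℂ E)}
    (hH : FiniteValuedConst H) : FiniteValuedConst ⁅H, H⁆ := by
  intro f hf hfin g hg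
  have step : ∀ x ∈ ⁅H, H⁆, ∀ a ∈ H, ∀ b ∈ H, f (x * (a * b * a⁻¹ * b⁻¹)) = f x := by
    intro x hx a ha b hb
    have hreg : IsRegularMap (fun b : SpecialLinearGroup ℂ E => x * (a * b * a⁻¹ * b⁻¹)) :=
      (IsRegularMap.const x).mul ((((IsRegularMap.const a).mul .id).mul (.const a⁻¹)).mul
        IsRegularMap.id.inv)
    have := hH _ (hreg f hf) (hfin.subset (by
      rintro _ ⟨y, hy, rfl⟩
      exact ⟨_, Subgroup.mul_mem _ hx (Subgroup.commutator_mem_commutator ha hy), rfl⟩)) b hb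
    simpa using this
  have hall : ∀ g ∈ ⁅H, H⁆, ∀ x ∈ ⁅H, H⁆, f (x * g) = f x := by
    intro g hg
    rw [Subgroup.commutator_def] at hg
    induction hg using Subgroup.closure_induction with
    | mem y hy =>
      obtain ⟨a, ha, b, hb, rfl⟩ := hy
      exact fun x hx => step x hx a ha b hb
    | one => simp
    | mul y z hy hz ihy ihz =>
      intro x hx
      rw [← mul_assoc, ihz _ (Subgroup.mul_mem _ hx hy), ihy _ hx]
    | inv y hy ih =>
      intro x hx
      have := ih (x * y⁻¹) (Subgroup.mul_mem _ hx (Subgroup.inv_mem _ hy))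
      rw [← this, inv_mul_cancel_right]
  simpa using hall g hg 1 (Subgroup.one_mem _)

end RegularFunctions

/-! ### Derived subgroups and the two basic representations -/

/-- The `k`-th derived subgroup of a subgroup, as a subgroup of the ambient group. -/
def iteratedCommutator {G : Type*} [Group G] (k : ℕ) (H : Subgroup G) : Subgroup G :=
  (fun K : Subgroup G => ⁅K, K⁆)^[k] H

theorem map_derivedSeries_subtype {G : Type*} [Group G] (H : Subgroup G) (k : ℕ) :
    (derivedSeries H k).map H.subtype = iteratedCommutator k H := by
  induction k with
  | zero => simp [iteratedCommutator, ← MonoidHom.range_eq_map]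
  | succ k ih =>
    rw [derivedSeries_succ, Subgroup.map_commutator, ih, iteratedCommutator, iteratedCommutator,
      Function.iterate_succ_apply']

theorem isSolvable_iff_iteratedCommutator {G : Type*} [Group G] (H : Subgroup G) :
    Group.IsSolvable H ↔ ∃ k, iteratedCommutator k H = ⊥ := by
  rw [Group.isSolvable_def]
  refine exists_congr fun k => ?_
  rw [← map_derivedSeries_subtype, Subgroup.map_eq_bot_iff_of_injective _ H.subtype_injective]

/-- The standard representation of `SL(E)`. -/
def standardRep (E : Type*) [AddCommGroup E] [Module ℂ E] :
    SpecialLinearGroup ℂ E →* Module.End ℂ E where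
  toFun g := ((g : E ≃ₗ[ℂ] E) : Module.End ℂ E)
  map_one' := rfl
  map_mul' _ _ := rfl

/-- The dual of the standard representation of `SL(E)`. -/
def dualRep (E : Type*) [AddCommGroup E] [Module ℂ E] :
    SpecialLinearGroup ℂ E →* Module.End ℂ (Module.Dual ℂ E) where
  toFun g := ((g : E ≃ₗ[ℂ] E).symm.dualMap : Module.Dual ℂ E →ₗ[ℂ] Module.Dual ℂ E)
  map_one' := rfl
  map_mul' _ _ := rfl

theorem standardRep_apply {E : Type*} [AddCommGroup E] [Module ℂ E]
    (g : SpecialLinearGroup ℂ E) (v : E) :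
    standardRep E g v = (g : E ≃ₗ[ℂ] E) v := rfl

theorem dualRep_apply {E : Type*} [AddCommGroup E] [Module ℂ E]
    (g : SpecialLinearGroup ℂ E) (f : Module.Dual ℂ E) (v : E) :
    dualRep E g f v = f ((g : E ≃ₗ[ℂ] E).symm v) := rfl

/-! ### The Lie–Kolchin theorem and invariant flags -/

section LieKolchin

variable {E : Type*} [AddCommGroup E] [Module ℂ E] [FiniteDimensional ℂ E]
  {V : Type*} [AddCommGroup V] [Module ℂ V] [FiniteDimensional ℂ V]

theorem exists_eigenvector_mem (f : Module.End ℂ V) {W : Submodule ℂ V} (hW : ∀ w ∈ W, f w ∈ W)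
    (hne : W ≠ ⊥) : ∃ (c : ℂ) (w : V), w ∈ W ∧ w ≠ 0 ∧ f w = c • w := by
  have : Nontrivial W := Submodule.nontrivial_iff_ne_bot.mpr hne
  obtain ⟨c, hc⟩ := Module.End.exists_eigenvalue (f.restrict hW)
  obtain ⟨w, hw⟩ := hc.exists_hasEigenvector
  refine ⟨c, w, w.2, fun h => hw.2 (Subtype.ext h), ?_⟩
  simpa using congrArg Subtype.val hw.apply_eq_smul

theorem finite_eigenvalues (f : Module.End ℂ V) :
    {c : ℂ | ∃ w : V, w ≠ 0 ∧ f w = c • w}.Finite := by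
  refine (Module.End.finite_hasEigenvalue f).subset ?_
  rintro c ⟨w, hw, h⟩
  exact Module.End.hasEigenvalue_of_hasEigenvector
    ⟨Module.End.mem_eigenspace_iff.mpr h, hw⟩

/-- **Lie–Kolchin**: a solvable subgroup of `SL(E)` on which finite-valued regular functions are
constant has an eigenvector in each nonzero invariant subspace of a rational representation. -/
theorem exists_common_eigenvector (ρ : SpecialLinearGroup ℂ E →* Module.End ℂ V)
    (hρ : ∀ (φ : Module.Dual ℂ V) (v : V), (fun g => φ (ρ g v)) ∈ regularFunctions E) (k : ℕ) :
    ∀ H : Subgroup (SpecialLinearGroup ℂ E), FiniteValuedConst H → iteratedCommutator k H = ⊥ →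
    ∀ (n : ℕ) (W : Submodule ℂ V), Module.finrank ℂ W = n → W ≠ ⊥ →
      (∀ g ∈ H, ∀ w ∈ W, ρ g w ∈ W) →
      ∃ v ∈ W, v ≠ 0 ∧ ∀ g ∈ H, ∃ c : ℂ, ρ g v = c • v := by
  induction k with
  | zero =>
    intro H _ hk n W _ hne _
    obtain ⟨v, hv, hv0⟩ := Submodule.exists_mem_ne_zero_of_ne_bot hne
    refine ⟨v, hv, hv0, fun g hg => ⟨1, ?_⟩⟩
    have : g = 1 := by
      have : H = ⊥ := hk
      simpa [this] using hg
    simp [this]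
  | succ k ihk =>
    intro H hH hk n
    induction n using Nat.strong_induction_on with
    | _ n ihn =>
    intro W hn hne hW
    have smaller : ∀ W' : Submodule ℂ V, W' < W → W' ≠ ⊥ → (∀ g ∈ H, ∀ w ∈ W', ρ g w ∈ W') →
        ∃ v ∈ W, v ≠ 0 ∧ ∀ g ∈ H, ∃ c : ℂ, ρ g v = c • v := by
      intro W' hlt hne' hinv
      obtain ⟨v, hv, h⟩ := ihn _ (hn ▸ Submodule.finrank_lt_finrank_of_lt hlt) W' rfl hne' hinv
      exact ⟨v, hlt.le hv, h⟩
    have hmul : ∀ g h v, ρ (g * h) v = ρ g (ρ h v) := fun g h v => by rw [map_mul]; rfl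
    have hinj : ∀ g v, v ≠ 0 → ρ g v ≠ 0 := by
      intro g v hv h0
      apply hv
      have := hmul g⁻¹ g v
      rw [h0, inv_mul_cancel, map_one, map_zero] at this
      exact this
    have hreg : ∀ (θ : SpecialLinearGroup ℂ E → SpecialLinearGroup ℂ E), IsRegularMap θ →
        ∀ (φ : Module.Dual ℂ V) (v : V), (fun g => φ (ρ (θ g) v)) ∈ regularFunctions E :=
      fun θ hθ φ v => hθ _ (hρ φ v)
    -- an eigenvector of the derived subgroup, and the corresponding weight space
    obtain ⟨v, hvW, hv0, hv⟩ := ihk ⁅H, H⁆ hH.commutator hk _ W rfl hne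
      (fun g hg => hW g (Subgroup.commutator_le_self H hg))
    obtain ⟨φ, hφ⟩ : ∃ φ : Module.Dual ℂ V, φ v = 1 := by
      obtain ⟨φ, hφ⟩ := Module.Projective.exists_dual_ne_zero ℂ hv0
      exact ⟨(φ v)⁻¹ • φ, by simp [hφ]⟩
    have hχ : ∀ h ∈ ⁅H, H⁆, ρ h v = φ (ρ h v) • v := by
      intro h hh
      obtain ⟨c, hc⟩ := hv h hh
      rw [hc]
      simp [hφ]
    have hconj : ∀ g ∈ H, ∀ h ∈ ⁅H, H⁆, g⁻¹ * h * g ∈ ⁅H, H⁆ := by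
      intro g hg h hh
      have : g⁻¹ * h * g = h * (h⁻¹ * g⁻¹ * h⁻¹⁻¹ * g⁻¹⁻¹) := by group
      rw [this]
      exact Subgroup.mul_mem _ hh (Subgroup.commutator_mem_commutator
        (H.inv_mem (Subgroup.commutator_le_self H hh)) (H.inv_mem hg))
    -- For fixed `h` the left side is a regular function of `g`. Its values are eigenvalues of `ρ
    -- h`, with eigenvector `ρ g v`, so there are finitely many of them and the function is constant
    -- on `H`.
    have hχconj : ∀ g ∈ H, ∀ h ∈ ⁅H, H⁆, φ (ρ (g⁻¹ * h * g) v) = φ (ρ h v) := by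
      intro g hg h hh
      have h1 := hH _ (hreg (fun g => g⁻¹ * h * g)
        ((IsRegularMap.id.inv.mul (.const h)).mul .id) φ v)
        ((finite_eigenvalues (ρ h)).subset (by
          rintro _ ⟨y, hy, rfl⟩
          refine ⟨ρ y v, hinj _ _ hv0, ?_⟩
          have := hχ _ (hconj y hy h hh)
          simp only
          rw [← map_smul, ← this, ← hmul, ← hmul]
          congr 2
          group)) g hg
      simpa using h1
    let W' : Submodule ℂ V :=
      { carrier := {w | w ∈ W ∧ ∀ h ∈ ⁅H, H⁆, ρ h w = φ (ρ h v) • w}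
        add_mem' := fun {a b} ha hb => ⟨W.add_mem ha.1 hb.1, fun h hh => by
          rw [map_add, ha.2 h hh, hb.2 h hh, smul_add]⟩
        zero_mem' := ⟨W.zero_mem, fun h _ => by simp⟩
        smul_mem' := fun c a ha => ⟨W.smul_mem c ha.1, fun h hh => by
          rw [map_smul, ha.2 h hh, smul_comm]⟩ }
    have hW'le : W' ≤ W := fun w hw => hw.1
    have hW'ne : W' ≠ ⊥ := (Submodule.ne_bot_iff _).mpr ⟨v, ⟨hvW, hχ⟩, hv0⟩
    -- Because conjugation fixes the character, its weight space `W'` is `H`-stable; if it is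
    -- proper, induction on the dimension finishes.
    rcases hW'le.lt_or_eq with hlt | heq
    · refine smaller W' hlt hW'ne fun g hg w hw => ⟨hW g hg w hw.1, fun h hh => ?_⟩
      have e1 := hw.2 _ (hconj g hg h hh)
      rw [hχconj g hg h hh] at e1
      rw [← map_smul, ← e1, ← hmul, ← hmul]
      congr 2
      group
    -- the derived subgroup acts on `W` by a character, which is trivial
    have hscal : ∀ h ∈ ⁅H, H⁆, ∀ w ∈ W, ρ h w = φ (ρ h v) • w := by
      intro h hh w hw
      rw [← heq] at hw
      exact hw.2 h hh
    have hswap : ∀ a ∈ H, ∀ b ∈ H, ∀ w ∈ W,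
        ρ a (ρ b w) = φ (ρ (a * b * a⁻¹ * b⁻¹) v) • ρ b (ρ a w) := by
      intro a ha b hb w hw
      have hm : a * b * a⁻¹ * b⁻¹ ∈ ⁅H, H⁆ := Subgroup.commutator_mem_commutator ha hb
      rw [← hscal _ hm _ (hW b hb _ (hW a ha w hw)),
        ← hmul, ← hmul, ← hmul]
      congr 2
      group
    -- If `w` is an eigenvector of `ρ a` with eigenvalue `c`, then `ρ b w` is one whose eigenvalue
    -- is `c` times the character of the commutator. So this character takes finitely many values as
    -- `b` varies, and at `b = 1` it is 1.
    have htriv : ∀ a ∈ H, ∀ b ∈ H, φ (ρ (a * b * a⁻¹ * b⁻¹) v) = 1 := by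
      intro a ha b hb
      obtain ⟨c, w, hwW, hw0, hcw⟩ := exists_eigenvector_mem (ρ a) (hW a ha) hne
      have hc0 : c ≠ 0 := by
        rintro rfl
        exact hinj a w hw0 (by simpa using hcw)
      have := hH _ (hreg (fun b => a * b * a⁻¹ * b⁻¹)
        ((((IsRegularMap.const a).mul .id).mul (.const a⁻¹)).mul IsRegularMap.id.inv) φ v)
        (((finite_eigenvalues (ρ a)).image (fun μ => μ / c)).subset (by
          rintro _ ⟨y, hy, rfl⟩
          refine ⟨φ (ρ (a * y * a⁻¹ * y⁻¹) v) * c, ⟨ρ y w, hinj _ _ hw0, ?_⟩, by field_simp⟩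
          rw [hswap a ha y hy w hwW, hcw, map_smul, smul_smul])) b hb
      simpa [hφ] using this
    have hcomm : ∀ a ∈ H, ∀ b ∈ H, ∀ w ∈ W, ρ a (ρ b w) = ρ b (ρ a w) := by
      intro a ha b hb w hw
      rw [hswap a ha b hb w hw, htriv a ha b hb, one_smul]
    -- The operators now commute on `W`. Either all are scalar, or an eigenspace of a non-scalar one
    -- is a proper `H`-stable subspace.
    by_cases hall : ∀ g ∈ H, ∃ c : ℂ, ∀ w ∈ W, ρ g w = c • w
    · exact ⟨v, hvW, hv0, fun g hg => (hall g hg).imp fun c hc => hc v hvW⟩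
    · push Not at hall
      obtain ⟨g₀, hg₀, hnot⟩ := hall
      obtain ⟨c, w, hwW, hw0, hcw⟩ := exists_eigenvector_mem (ρ g₀) (hW g₀ hg₀) hne
      refine smaller (W ⊓ Module.End.eigenspace (ρ g₀) c) (lt_of_le_of_ne inf_le_left ?_) ?_ ?_
      · intro h
        obtain ⟨u, huW, hu⟩ := hnot c
        rw [← h] at huW
        exact hu (Module.End.mem_eigenspace_iff.mp huW.2)
      · exact (Submodule.ne_bot_iff _).mpr
          ⟨w, ⟨hwW, Module.End.mem_eigenspace_iff.mpr hcw⟩, hw0⟩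
      · intro g hg u hu
        refine ⟨hW g hg u hu.1, Module.End.mem_eigenspace_iff.mpr ?_⟩
        rw [hcomm g₀ hg₀ g hg u hu.1, Module.End.mem_eigenspace_iff.mp hu.2, map_smul]

/-- A connected solvable subgroup of `SL(E)`, `dim E = 3`, leaves a full flag invariant. -/
theorem exists_invariant_flag (hE : Module.finrank ℂ E = 3)
    {H : Subgroup (SpecialLinearGroup ℂ E)}
    (hc : @IsConnected _ (slZariski E) (H : Set (SpecialLinearGroup ℂ E)))
    (hs : Group.IsSolvable H) :
    ∃ F₁ F₂ : Submodule ℂ E, Module.finrank ℂ F₁ = 1 ∧ Module.finrank ℂ F₂ = 2 ∧ F₁ ≤ F₂ ∧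
      (∀ g ∈ H, ∀ v ∈ F₁, (g : E ≃ₗ[ℂ] E) v ∈ F₁) ∧
      (∀ g ∈ H, ∀ v ∈ F₂, (g : E ≃ₗ[ℂ] E) v ∈ F₂) := by
  have hF := finiteValuedConst_of_isConnected hc
  obtain ⟨k, hk⟩ := (isSolvable_iff_iteratedCommutator H).mp hs
  have hfd : Module.finrank ℂ (Module.Dual ℂ E) = 3 := by rw [Subspace.dual_finrank_eq, hE]
  -- An eigenvector in the dual is a linear form whose kernel is an invariant plane; Lie–Kolchin
  -- applied again inside that plane gives the line.
  obtain ⟨f, -, hf0, hf⟩ := exists_common_eigenvector (dualRep E) (by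
      intro Φ f
      obtain ⟨e, rfl⟩ := (Module.evalEquiv ℂ E).surjective Φ
      exact isRegularMap_inv _ (coeff_mem_regularFunctions f e)) k H hF hk _ ⊤ rfl
      (by
        intro h
        have := finrank_top ℂ (Module.Dual ℂ E)
        rw [h, finrank_bot] at this
        omega)
      (fun _ _ _ _ => Submodule.mem_top)
  have hF2 : Module.finrank ℂ (LinearMap.ker f) = 2 := by
    have := Module.Dual.finrank_ker_add_one_of_ne_zero hf0
    omega
  have hinv2 : ∀ g ∈ H, ∀ v ∈ LinearMap.ker f, (g : E ≃ₗ[ℂ] E) v ∈ LinearMap.ker f := by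
    intro g hg v hv
    obtain ⟨c, hc⟩ := hf _ (H.inv_mem hg)
    have := LinearMap.congr_fun hc v
    rw [dualRep_apply] at this
    rw [LinearMap.mem_ker] at hv ⊢
    rw [LinearMap.smul_apply, hv, smul_zero] at this
    exact this
  obtain ⟨v, hv, hv0, hve⟩ := exists_common_eigenvector (standardRep E)
    (fun φ v => coeff_mem_regularFunctions φ v) k H hF hk _ (LinearMap.ker f) rfl
    (by
      intro h
      rw [h, finrank_bot] at hF2
      omega) hinv2
  refine ⟨Submodule.span ℂ {v}, LinearMap.ker f, finrank_span_singleton hv0, hF2,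
    (Submodule.span_singleton_le_iff_mem _ _).mpr hv, ?_, hinv2⟩
  intro g hg w hw
  obtain ⟨c, rfl⟩ := Submodule.mem_span_singleton.mp hw
  obtain ⟨d, hd⟩ := hve g hg
  rw [standardRep_apply] at hd
  rw [map_smul, hd]
  exact Submodule.smul_mem _ _ (Submodule.smul_mem _ _ (Submodule.mem_span_singleton_self v))

end LieKolchin

/-! ### Flags and adapted bases -/

section Flags

variable {E : Type*} [AddCommGroup E] [Module ℂ E]

/-- A line contained in a plane. -/
def IsFlag (F₁ F₂ : Submodule ℂ E) : Prop :=
  Module.finrank ℂ F₁ = 1 ∧ Module.finrank ℂ F₂ = 2 ∧ F₁ ≤ F₂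

/-- The flag `F₁ ≤ F₂` is spanned by the initial vectors of the basis `b`. -/
def IsAdapted (b : Module.Basis (Fin 3) ℂ E) (F₁ F₂ : Submodule ℂ E) : Prop :=
  (∀ v, v ∈ F₁ ↔ b.coord 1 v = 0 ∧ b.coord 2 v = 0) ∧ ∀ v, v ∈ F₂ ↔ b.coord 2 v = 0

theorem sum_coord_smul (b : Module.Basis (Fin 3) ℂ E) (v : E) :
    v = b.coord 0 v • b 0 + b.coord 1 v • b 1 + b.coord 2 v • b 2 := by
  conv_lhs => rw [← b.sum_repr v]
  rw [Fin.sum_univ_three]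
  rfl

theorem IsFlag.exists_adapted (hE : Module.finrank ℂ E = 3) {F₁ F₂ : Submodule ℂ E}
    (h : IsFlag F₁ F₂) : ∃ b : Module.Basis (Fin 3) ℂ E, IsAdapted b F₁ F₂ := by
  obtain ⟨h₁, h₂, hle⟩ := h
  have : FiniteDimensional ℂ E := FiniteDimensional.of_finrank_pos (by omega)
  have hlt : F₁ < F₂ := lt_of_le_of_ne hle (by rintro rfl; omega)
  have hlt' : F₂ < ⊤ := lt_of_le_of_ne le_top (by rintro rfl; rw [finrank_top] at h₂; omega)
  obtain ⟨v₀, hv₀, hv₀'⟩ := Submodule.exists_mem_ne_zero_of_ne_bot (p := F₁)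
    (by rintro rfl; rw [finrank_bot] at h₁; omega)
  obtain ⟨v₁, hv₁, hv₁'⟩ := SetLike.exists_of_lt hlt
  obtain ⟨v₂, -, hv₂'⟩ := SetLike.exists_of_lt hlt'
  have key2 : ∀ c : ℂ, c • v₂ ∈ F₂ → c = 0 := by
    intro c hc
    by_contra hne
    exact hv₂' ((Submodule.smul_mem_iff _ hne).mp hc)
  have key1 : ∀ c : ℂ, c • v₁ ∈ F₁ → c = 0 := by
    intro c hc
    by_contra hne
    exact hv₁' ((Submodule.smul_mem_iff _ hne).mp hc)
  have hli : LinearIndependent ℂ ![v₀, v₁, v₂] := by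
    rw [Fintype.linearIndependent_iff]
    intro c hc
    simp only [Fin.sum_univ_three, Matrix.cons_val_zero, Matrix.cons_val_one,
      Matrix.cons_val] at hc
    have c2 : c 2 = 0 := key2 _ (by
      rw [show c 2 • v₂ = -(c 0 • v₀ + c 1 • v₁) from (neg_eq_of_add_eq_zero_right hc).symm]
      exact F₂.neg_mem (F₂.add_mem (F₂.smul_mem _ (hle hv₀)) (F₂.smul_mem _ hv₁)))
    rw [c2, zero_smul, add_zero] at hc
    have c1 : c 1 = 0 := key1 _ (by
      rw [show c 1 • v₁ = -(c 0 • v₀) from (neg_eq_of_add_eq_zero_right hc).symm]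
      exact F₁.neg_mem (F₁.smul_mem _ hv₀))
    rw [c1, zero_smul, add_zero] at hc
    have c0 : c 0 = 0 := (smul_eq_zero.mp hc).resolve_right hv₀'
    intro i
    fin_cases i <;> assumption
  let b := basisOfLinearIndependentOfCardEqFinrank hli (by simp [hE])
  have b0 : b 0 = v₀ := by simp [b]
  have b1 : b 1 = v₁ := by simp [b]
  have b2 : b 2 = v₂ := by simp [b]
  have hF₂ : ∀ v, v ∈ F₂ ↔ b.coord 2 v = 0 := by
    intro v
    have hv := sum_coord_smul b v
    rw [b0, b1, b2] at hv
    have hm : b.coord 0 v • v₀ + b.coord 1 v • v₁ ∈ F₂ :=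
      F₂.add_mem (F₂.smul_mem _ (hle hv₀)) (F₂.smul_mem _ hv₁)
    constructor
    · intro h
      rw [hv] at h
      exact key2 _ ((Submodule.add_mem_iff_right _ hm).mp h)
    · intro h
      rw [h, zero_smul, add_zero] at hv
      rw [hv]
      exact hm
  refine ⟨b, fun v => ?_, hF₂⟩
  have hv := sum_coord_smul b v
  rw [b0, b1, b2] at hv
  have hm : b.coord 0 v • v₀ ∈ F₁ := F₁.smul_mem _ hv₀
  constructor
  · intro h
    have h2 := (hF₂ v).mp (hle h)
    rw [h2, zero_smul, add_zero] at hv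
    rw [hv] at h
    exact ⟨key1 _ ((Submodule.add_mem_iff_right _ hm).mp h), h2⟩
  · rintro ⟨h1, h2⟩
    rw [h1, h2, zero_smul, zero_smul, add_zero, add_zero] at hv
    rw [hv]
    exact hm

theorem IsAdapted.le {b : Module.Basis (Fin 3) ℂ E} {F₁ F₂ : Submodule ℂ E}
    (h : IsAdapted b F₁ F₂) : F₁ ≤ F₂ := fun v hv => (h.2 v).mpr ((h.1 v).mp hv).2

/-- The members of a flag in a three-dimensional space, indexed by their dimension. -/
def flagSpace (F₁ F₂ : Submodule ℂ E) : ℕ → Submodule ℂ E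
  | 0 => ⊥
  | 1 => F₁
  | 2 => F₂
  | _ + 3 => ⊤

theorem flagSpace_mono {F₁ F₂ : Submodule ℂ E} (h : F₁ ≤ F₂) : Monotone (flagSpace F₁ F₂) := by
  refine monotone_nat_of_le_succ fun n => ?_
  match n with
  | 0 => exact bot_le
  | 1 => exact h
  | _ + 2 => exact le_top

/-- This says that the successive quotients of the flag are at most one-dimensional, in the
elementwise form needed for the first commutator step. -/
theorem IsAdapted.exists_sub_smul_mem {b : Module.Basis (Fin 3) ℂ E} {F₁ F₂ : Submodule ℂ E}
    (h : IsAdapted b F₁ F₂) (k : ℕ) : ∃ e ∈ flagSpace F₁ F₂ (k + 1),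
      ∀ w ∈ flagSpace F₁ F₂ (k + 1), ∃ c : ℂ, w - c • e ∈ flagSpace F₁ F₂ k := by
  match k with
  | 0 =>
    refine ⟨b 0, (h.1 _).mpr (by simp), fun w hw => ⟨b.coord 0 w, ?_⟩⟩
    obtain ⟨h1, h2⟩ := (h.1 w).mp hw
    have := sum_coord_smul b w
    rw [h1, h2, zero_smul, zero_smul, add_zero, add_zero] at this
    rw [← this, sub_self]
    exact Submodule.zero_mem _
  | 1 =>
    refine ⟨b 1, (h.2 _).mpr (by simp), fun w hw => ⟨b.coord 1 w, (h.1 _).mpr ?_⟩⟩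
    have h2 := (h.2 w).mp hw
    simp only [map_sub, map_smul, h2]
    simp
  | 2 =>
    exact ⟨b 2, Submodule.mem_top, fun w _ => ⟨b.coord 2 w, (h.2 _).mpr (by simp)⟩⟩
  | k + 3 => exact ⟨0, Submodule.mem_top, fun w _ => ⟨0, Submodule.mem_top⟩⟩

/-! ### Solvability and closedness of the flag stabilizer -/

section Filtration

variable [FiniteDimensional ℂ E]

theorem mem_of_apply_mem (g : E ≃ₗ[ℂ] E) {F : Submodule ℂ E} (h : ∀ v ∈ F, g v ∈ F) {v : E}
    (hv : g v ∈ F) : v ∈ F := by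
  have hle : F.map (g : E →ₗ[ℂ] E) ≤ F := by
    rintro _ ⟨w, hw, rfl⟩
    exact h w hw
  have heq : F.map (g : E →ₗ[ℂ] E) = F :=
    Submodule.eq_of_le_of_finrank_eq hle (LinearEquiv.finrank_map_eq g F)
  rw [← heq] at hv
  obtain ⟨w, hw, hwv⟩ := hv
  rwa [← g.injective hwv]

/-- The elements of `SL(E)` which lower the filtration `F` by `k` steps up to the identity. -/
def filtrationSubgroup (F : ℕ → Submodule ℂ E) (hF : Monotone F) (k : ℕ) :
    Subgroup (SpecialLinearGroup ℂ E) where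
  -- The subtraction is truncated: for `i ≤ k` the difference must lie in `F 0`, which is `⊥` for a
  -- flag.
  carrier := {g | ∀ i, ∀ v ∈ F i, (g : E ≃ₗ[ℂ] E) v - v ∈ F (i - k)}
  one_mem' := fun i v _ => by simp
  mul_mem' := by
    intro g h hg hh i v hv
    have h1 := hh i v hv
    have h2 : (h : E ≃ₗ[ℂ] E) v ∈ F i := by
      have := (F i).add_mem (hF (Nat.sub_le i k) h1) hv
      rwa [sub_add_cancel] at this
    have := (F (i - k)).add_mem (hg i _ h2) h1
    rwa [sub_add_sub_cancel] at this
  inv_mem' := by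
    intro g hg i v hv
    have hst : ∀ w ∈ F i, (g : E ≃ₗ[ℂ] E) w ∈ F i := by
      intro w hw
      have := (F i).add_mem (hF (Nat.sub_le i k) (hg i w hw)) hw
      rwa [sub_add_cancel] at this
    have hgv : (g : E ≃ₗ[ℂ] E) ((g : E ≃ₗ[ℂ] E).symm v) = v := LinearEquiv.apply_symm_apply _ v
    have hm : (g : E ≃ₗ[ℂ] E).symm v ∈ F i := mem_of_apply_mem _ hst (by rwa [hgv])
    have := hg i _ hm
    rw [hgv] at this
    have h2 := (F (i - k)).neg_mem this
    rwa [neg_sub] at h2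

theorem apply_mem_of_mem_filtrationSubgroup {F : ℕ → Submodule ℂ E} {hF : Monotone F} {k : ℕ}
    {g : SpecialLinearGroup ℂ E} (hg : g ∈ filtrationSubgroup F hF k) {i : ℕ} {v : E}
    (hv : v ∈ F i) : (g : E ≃ₗ[ℂ] E) v ∈ F i := by
  have := (F i).add_mem (hF (Nat.sub_le i k) (hg i v hv)) hv
  rwa [sub_add_cancel] at this

/-- Put `w = x⁻¹ y⁻¹ v`. Then `y x w = v`, so the group commutator of `x` and `y` moves `v` by `x y
w - y x w`, and additive commutators suffice. -/
theorem commutator_le_filtrationSubgroup {F : ℕ → Submodule ℂ E} {hF : Monotone F} {k l : ℕ}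
    (h : ∀ g ∈ filtrationSubgroup F hF k, ∀ h ∈ filtrationSubgroup F hF k, ∀ i, ∀ w ∈ F i,
      (g : E ≃ₗ[ℂ] E) ((h : E ≃ₗ[ℂ] E) w) - (h : E ≃ₗ[ℂ] E) ((g : E ≃ₗ[ℂ] E) w) ∈ F (i - l)) :
    ⁅filtrationSubgroup F hF k, filtrationSubgroup F hF k⁆ ≤ filtrationSubgroup F hF l := by
  rw [Subgroup.commutator_le]
  intro x hx y hy i v hv
  set w : E := ((x⁻¹ * y⁻¹ : SpecialLinearGroup ℂ E) : E ≃ₗ[ℂ] E) v with hw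
  have hwF : w ∈ F i := apply_mem_of_mem_filtrationSubgroup
    (Subgroup.mul_mem _ (Subgroup.inv_mem _ hx) (Subgroup.inv_mem _ hy)) hv
  have h1 : (y : E ≃ₗ[ℂ] E) ((x : E ≃ₗ[ℂ] E) w) = v := by
    have : ((y * x * (x⁻¹ * y⁻¹) : SpecialLinearGroup ℂ E) : E ≃ₗ[ℂ] E) v = v := by
      rw [show y * x * (x⁻¹ * y⁻¹) = 1 by group]
      rfl
    exact this
  have := h x hx y hy i w hwF
  rw [h1] at this
  exact this

/-- Each element acts by a scalar on every one-dimensional graded piece, and scalars commute. -/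
theorem commutator_filtrationSubgroup_zero_le {F : ℕ → Submodule ℂ E} {hF : Monotone F}
    (h0 : F 0 = ⊥)
    (h1 : ∀ k, ∃ e ∈ F (k + 1), ∀ w ∈ F (k + 1), ∃ c : ℂ, w - c • e ∈ F k) :
    ⁅filtrationSubgroup F hF 0, filtrationSubgroup F hF 0⁆ ≤ filtrationSubgroup F hF 1 := by
  refine commutator_le_filtrationSubgroup fun x hx y hy i w hw => ?_
  match i with
  | 0 =>
    rw [h0, Submodule.mem_bot] at hw
    simp [hw]
  | k + 1 =>
    obtain ⟨e, he, hspan⟩ := h1 k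
    have scalar : ∀ g ∈ filtrationSubgroup F hF 0, ∃ a : ℂ, ∀ w ∈ F (k + 1),
        (g : E ≃ₗ[ℂ] E) w - a • w ∈ F k := by
      intro g hg
      obtain ⟨a, ha⟩ := hspan _ (apply_mem_of_mem_filtrationSubgroup hg he)
      refine ⟨a, fun w hw => ?_⟩
      obtain ⟨c, hc⟩ := hspan w hw
      have e1 : (g : E ≃ₗ[ℂ] E) w - a • w = (g : E ≃ₗ[ℂ] E) (w - c • e) - a • (w - c • e) +
          c • ((g : E ≃ₗ[ℂ] E) e - a • e) := by
        rw [map_sub, map_smul]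
        module
      rw [e1]
      exact (F k).add_mem ((F k).sub_mem (apply_mem_of_mem_filtrationSubgroup hg hc)
        ((F k).smul_mem _ hc)) ((F k).smul_mem _ ha)
    obtain ⟨a, ha⟩ := scalar x hx
    obtain ⟨c, hc⟩ := scalar y hy
    have e1 : (x : E ≃ₗ[ℂ] E) ((y : E ≃ₗ[ℂ] E) w) - (y : E ≃ₗ[ℂ] E) ((x : E ≃ₗ[ℂ] E) w) =
        ((x : E ≃ₗ[ℂ] E) ((y : E ≃ₗ[ℂ] E) w) - a • (y : E ≃ₗ[ℂ] E) w) -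
        ((y : E ≃ₗ[ℂ] E) ((x : E ≃ₗ[ℂ] E) w) - c • (x : E ≃ₗ[ℂ] E) w) +
        a • ((y : E ≃ₗ[ℂ] E) w - c • w) - c • ((x : E ≃ₗ[ℂ] E) w - a • w) := by
      module
    rw [e1]
    exact (F k).sub_mem ((F k).add_mem ((F k).sub_mem
      (ha _ (apply_mem_of_mem_filtrationSubgroup hy hw))
      (hc _ (apply_mem_of_mem_filtrationSubgroup hx hw))) ((F k).smul_mem _ (hc _ hw)))
      ((F k).smul_mem _ (ha _ hw))

/-- This rests on `xy - yx = (x - 1)(y - 1) - (y - 1)(x - 1)`, where each factor lowers the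
filtration by `k`. -/
theorem commutator_filtrationSubgroup_le {F : ℕ → Submodule ℂ E} {hF : Monotone F} (k : ℕ) :
    ⁅filtrationSubgroup F hF k, filtrationSubgroup F hF k⁆ ≤
      filtrationSubgroup F hF (k + k) := by
  refine commutator_le_filtrationSubgroup fun x hx y hy i w hw => ?_
  have e1 : (x : E ≃ₗ[ℂ] E) ((y : E ≃ₗ[ℂ] E) w) - (y : E ≃ₗ[ℂ] E) ((x : E ≃ₗ[ℂ] E) w) =
      ((x : E ≃ₗ[ℂ] E) ((y : E ≃ₗ[ℂ] E) w - w) - ((y : E ≃ₗ[ℂ] E) w - w)) -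
      ((y : E ≃ₗ[ℂ] E) ((x : E ≃ₗ[ℂ] E) w - w) - ((x : E ≃ₗ[ℂ] E) w - w)) := by
    rw [map_sub, map_sub]
    module
  rw [e1, ← Nat.sub_sub]
  exact Submodule.sub_mem _ (hx _ _ (hy _ _ hw)) (hy _ _ (hx _ _ hw))

/-- The stabilizer in `SL(E)` of a flag. -/
def flagStabilizer {F₁ F₂ : Submodule ℂ E} (h : F₁ ≤ F₂) : Subgroup (SpecialLinearGroup ℂ E) :=
  filtrationSubgroup (flagSpace F₁ F₂) (flagSpace_mono h) 0

theorem mem_flagStabilizer {F₁ F₂ : Submodule ℂ E} {h : F₁ ≤ F₂} {g : SpecialLinearGroup ℂ E} :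
    g ∈ flagStabilizer h ↔ (∀ v ∈ F₁, (g : E ≃ₗ[ℂ] E) v ∈ F₁) ∧
      ∀ v ∈ F₂, (g : E ≃ₗ[ℂ] E) v ∈ F₂ := by
  constructor
  · intro hg
    exact ⟨fun v hv => apply_mem_of_mem_filtrationSubgroup hg (i := 1) hv,
      fun v hv => apply_mem_of_mem_filtrationSubgroup hg (i := 2) hv⟩
  · rintro ⟨h1, h2⟩ i v hv
    match i with
    | 0 =>
      have : v = 0 := hv
      simp [this]
    | 1 => exact F₁.sub_mem (h1 v hv) hv
    | 2 => exact F₂.sub_mem (h2 v hv) hv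
    | i + 3 => exact Submodule.mem_top

/-- Successive derived subgroups lie in the filtration subgroups of levels 1, 2 and 4. At level 4
every `g v - v` lies in `F (3 - 4) = F 0 = ⊥`, so the third derived subgroup is trivial. -/
theorem IsAdapted.isSolvable_flagStabilizer {b : Module.Basis (Fin 3) ℂ E}
    {F₁ F₂ : Submodule ℂ E} (h : IsAdapted b F₁ F₂) :
    Group.IsSolvable (flagStabilizer h.le) := by
  rw [isSolvable_iff_iteratedCommutator]
  refine ⟨3, le_bot_iff.mp ?_⟩
  have s1 := commutator_filtrationSubgroup_zero_le (hF := flagSpace_mono h.le) rfl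
    h.exists_sub_smul_mem
  have s2 := (Subgroup.commutator_mono s1 s1).trans (commutator_filtrationSubgroup_le 1)
  have s3 := (Subgroup.commutator_mono s2 s2).trans (commutator_filtrationSubgroup_le 2)
  refine s3.trans fun g hg => ?_
  have : ∀ v : E, (g : E ≃ₗ[ℂ] E) v - v = 0 := fun v => hg 3 v Submodule.mem_top
  rw [Subgroup.mem_bot]
  ext v
  exact sub_eq_zero.mp (this v)

theorem IsAdapted.mem_flagStabilizer_iff {b : Module.Basis (Fin 3) ℂ E}
    {F₁ F₂ : Submodule ℂ E} (h : IsAdapted b F₁ F₂) {g : SpecialLinearGroup ℂ E} :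
    g ∈ flagStabilizer h.le ↔ b.coord 1 ((g : E ≃ₗ[ℂ] E) (b 0)) = 0 ∧
      b.coord 2 ((g : E ≃ₗ[ℂ] E) (b 0)) = 0 ∧ b.coord 2 ((g : E ≃ₗ[ℂ] E) (b 1)) = 0 := by
  rw [mem_flagStabilizer]
  constructor
  · rintro ⟨h1, h2⟩
    have h3 := (h.1 _).mp (h1 (b 0) ((h.1 _).mpr (by simp)))
    exact ⟨h3.1, h3.2, (h.2 _).mp (h2 (b 1) ((h.2 _).mpr (by simp)))⟩
  · rintro ⟨h1, h2, h3⟩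
    constructor
    · intro v hv
      obtain ⟨e1, e2⟩ := (h.1 v).mp hv
      refine (h.1 _).mpr ?_
      rw [sum_coord_smul b v, e1, e2]
      simp only [zero_smul, add_zero, map_smul, h1, h2, smul_zero, and_self]
    · intro v hv
      have e2 := (h.2 v).mp hv
      refine (h.2 _).mpr ?_
      rw [sum_coord_smul b v, e2]
      simp only [zero_smul, add_zero, map_add, map_smul, h3, h2, smul_zero]

theorem IsAdapted.isClosed_flagStabilizer {b : Module.Basis (Fin 3) ℂ E}
    {F₁ F₂ : Submodule ℂ E} (h : IsAdapted b F₁ F₂) :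
    IsClosed[slZariski E] (flagStabilizer h.le : Set (SpecialLinearGroup ℂ E)) := by
  let := slZariski E
  have : (flagStabilizer h.le : Set (SpecialLinearGroup ℂ E)) =
      {g : SpecialLinearGroup ℂ E | b.coord 1 ((g : E ≃ₗ[ℂ] E) (b 0)) = 0} ∩
      ({g : SpecialLinearGroup ℂ E | b.coord 2 ((g : E ≃ₗ[ℂ] E) (b 0)) = 0} ∩
        {g : SpecialLinearGroup ℂ E | b.coord 2 ((g : E ≃ₗ[ℂ] E) (b 1)) = 0}) := by
    ext g
    exact h.mem_flagStabilizer_iff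
  rw [this]
  exact (isClosed_zeroLocus (coeff_mem_regularFunctions _ _)).inter
    ((isClosed_zeroLocus (coeff_mem_regularFunctions _ _)).inter
      (isClosed_zeroLocus (coeff_mem_regularFunctions _ _)))

end Filtration

/-! ### Matrix paths and connectedness of the flag stabilizer -/

/-- The element of `SL(E)` with matrix `M` in the basis `b`. -/
def slOfMatrix (b : Module.Basis (Fin 3) ℂ E) (M : Matrix (Fin 3) (Fin 3) ℂ) (hM : M.det = 1) :
    SpecialLinearGroup ℂ E :=
  Matrix.SpecialLinearGroup.toLin_equiv b ⟨M, hM⟩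

theorem coord_slOfMatrix (b : Module.Basis (Fin 3) ℂ E) (M : Matrix (Fin 3) (Fin 3) ℂ)
    (hM : M.det = 1) (i j : Fin 3) :
    b.coord i ((slOfMatrix b M hM : E ≃ₗ[ℂ] E) (b j)) = M i j := by
  have : (slOfMatrix b M hM : E ≃ₗ[ℂ] E) (b j) = Matrix.toLin b b M (b j) := rfl
  rw [this, Matrix.toLin_self, map_sum]
  simp [Finsupp.single_apply]

theorem sl_ext_basis (b : Module.Basis (Fin 3) ℂ E) {g h : SpecialLinearGroup ℂ E}
    (H : ∀ i j, b.coord i ((g : E ≃ₗ[ℂ] E) (b j)) = b.coord i ((h : E ≃ₗ[ℂ] E) (b j))) :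
    g = h := by
  apply Subtype.ext
  apply LinearEquiv.toLinearMap_injective
  exact b.ext fun j => b.ext_elem fun i => H i j

/-- Polynomials are continuous for the usual topology, so ordinary continuous paths can be used to
prove Zariski connectedness. -/
theorem continuous_slOfMatrix (b : Module.Basis (Fin 3) ℂ E) (M : ℂ → Matrix (Fin 3) (Fin 3) ℂ)
    (hM : ∀ s, (M s).det = 1) (hc : Continuous M) :
    @Continuous ℂ _ _ (slZariski E) (fun s => slOfMatrix b (M s) (hM s)) := by
  let := affineZariski (Module.End ℂ E)
  refine continuous_induced_rng.mpr (continuous_generateFrom_iff.mpr ?_)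
  rintro _ ⟨P, rfl⟩
  have hcont : Continuous fun s => polyEval (Module.End ℂ E) P (Matrix.toLin b b (M s)) := by
    refine (MvPolynomial.continuous_eval P).comp (continuous_pi fun φ => ?_)
    exact (LinearMap.continuous_of_finiteDimensional
      (φ.comp (Matrix.toLin b b).toLinearMap)).comp hc
  exact (isOpen_compl_singleton (x := (0 : ℂ))).preimage hcont

/-- Every triangular matrix is joined to 1 inside the group by a continuous image of `ℂ`: scale the
logarithms of the first two diagonal entries and the entries above the diagonal by `s`, and let the
determinant dictate the last diagonal entry. -/
theorem IsAdapted.isConnected_flagStabilizer [FiniteDimensional ℂ E]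
    {b : Module.Basis (Fin 3) ℂ E} {F₁ F₂ : Submodule ℂ E} (h : IsAdapted b F₁ F₂) :
    @IsConnected _ (slZariski E) (flagStabilizer h.le : Set (SpecialLinearGroup ℂ E)) := by
  let := slZariski E
  refine ⟨⟨1, Subgroup.one_mem _⟩, isPreconnected_of_forall 1 fun g hg => ?_⟩
  obtain ⟨h10, h20, h21⟩ := h.mem_flagStabilizer_iff.mp hg
  set a : Fin 3 → Fin 3 → ℂ := fun i j => b.coord i ((g : E ≃ₗ[ℂ] E) (b j)) with ha
  have hdet : a 0 0 * a 1 1 * a 2 2 = 1 := by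
    have h1 : LinearMap.det ((g : E ≃ₗ[ℂ] E) : E →ₗ[ℂ] E) = 1 :=
      SpecialLinearGroup.det_eq_one g
    rw [← LinearMap.det_toMatrix b, Matrix.det_fin_three] at h1
    simp only [LinearMap.toMatrix_apply] at h1
    change a 0 0 * a 1 1 * a 2 2 - a 0 0 * a 1 2 * a 2 1 - a 0 1 * a 1 0 * a 2 2
      + a 0 1 * a 1 2 * a 2 0 + a 0 2 * a 1 0 * a 2 1 - a 0 2 * a 1 1 * a 2 0 = 1 at h1
    have e1 : a 1 0 = 0 := h10
    have e2 : a 2 0 = 0 := h20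
    have e3 : a 2 1 = 0 := h21
    rw [e1, e2, e3] at h1
    linear_combination h1
  have ha0 : a 0 0 ≠ 0 := fun h0 => by simp [h0] at hdet
  have ha1 : a 1 1 ≠ 0 := fun h0 => by simp [h0] at hdet
  set l₀ := Complex.log (a 0 0)
  set l₁ := Complex.log (a 1 1)
  have hl₀ : Complex.exp l₀ = a 0 0 := Complex.exp_log ha0
  have hl₁ : Complex.exp l₁ = a 1 1 := Complex.exp_log ha1
  let M : ℂ → Matrix (Fin 3) (Fin 3) ℂ := fun s =>
    !![Complex.exp (s * l₀), s * a 0 1, s * a 0 2;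
      0, Complex.exp (s * l₁), s * a 1 2;
      0, 0, Complex.exp (-(s * l₀ + s * l₁))]
  have hM : ∀ s, (M s).det = 1 := by
    intro s
    rw [Matrix.det_fin_three]
    simp [M, ← Complex.exp_add]
  have hMc : Continuous M := by
    refine continuous_matrix fun i j => ?_
    fin_cases i <;> fin_cases j <;> simp [M] <;> fun_prop
  refine ⟨Set.range fun s => slOfMatrix b (M s) (hM s), ?_, ⟨0, ?_⟩, ⟨1, ?_⟩,
    isPreconnected_range (continuous_slOfMatrix b M hM hMc)⟩
  · rintro _ ⟨s, rfl⟩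
    refine h.mem_flagStabilizer_iff.mpr ?_
    simp only [coord_slOfMatrix]
    simp [M]
  · refine sl_ext_basis b fun i j => ?_
    simp only [coord_slOfMatrix]
    fin_cases i <;> fin_cases j <;> simp [M]
  · refine sl_ext_basis b fun i j => ?_
    simp only [coord_slOfMatrix]
    have e22 : Complex.exp (-(l₀ + l₁)) = a 2 2 := by
      rw [Complex.exp_neg, Complex.exp_add, hl₀, hl₁]
      exact inv_eq_of_mul_eq_one_right hdet
    have a10 : (b.repr ((g : E ≃ₗ[ℂ] E) (b 0))) 1 = 0 := h10
    have a20 : (b.repr ((g : E ≃ₗ[ℂ] E) (b 0))) 2 = 0 := h20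
    have a21 : (b.repr ((g : E ≃ₗ[ℂ] E) (b 1))) 2 = 0 := h21
    have e22' : Complex.exp (-l₁ + -l₀) = a 2 2 := by rw [← e22, neg_add, add_comm]
    fin_cases i <;> fin_cases j <;>
      simp [M, hl₀, hl₁, e22', a10, a20, a21] <;> simp [a]

/-! ### Borel subgroups are flag stabilizers -/

section Borel

/-- The transvection `v ↦ v + f(v) w` as an element of `SL(E)`. -/
def slTransvection {f : Module.Dual ℂ E} {w : E} (h : f w = 0) : SpecialLinearGroup ℂ E :=
  ⟨LinearEquiv.transvection h, LinearEquiv.transvection.det_eq_one h⟩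

theorem slTransvection_apply {f : Module.Dual ℂ E} {w : E} (h : f w = 0) (v : E) :
    (slTransvection h : E ≃ₗ[ℂ] E) v = v + f v • w :=
  LinearEquiv.transvection.apply h v

/-- Take `v ∈ F'` outside `F` and a form `f` that kills `F` but not `v`. The transvection moves `v`
by the nonzero multiple `f v • w`, which forces `w ∈ F'`. -/
theorem le_of_forall_transvection_mem {F F' : Submodule ℂ E} (hne : ¬ F' ≤ F)
    (h : ∀ (f : Module.Dual ℂ E) (w : E) (hfw : f w = 0), (∀ v ∈ F, f v = 0) → w ∈ F →
      ∀ v ∈ F', (slTransvection hfw : E ≃ₗ[ℂ] E) v ∈ F') : F ≤ F' := by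
  obtain ⟨v, hv, hvF⟩ := SetLike.not_le_iff_exists.mp hne
  obtain ⟨f, hfv, hf⟩ := Submodule.exists_le_ker_of_notMem hvF
  intro w hw
  have h1 : v + f v • w ∈ F' := h f w (hf hw) (fun v hv => hf hv) hw v hv
  rw [Submodule.add_mem_iff_right _ hv] at h1
  exact (Submodule.smul_mem_iff _ hfv).mp h1

variable [FiniteDimensional ℂ E]

theorem slTransvection_mem_flagStabilizer {F₁ F₂ : Submodule ℂ E} {hle : F₁ ≤ F₂}
    {f : Module.Dual ℂ E} {w : E} (hfw : f w = 0) (h₁ : ∀ v ∈ F₁, f v • w ∈ F₁)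
    (h₂ : ∀ v ∈ F₂, f v • w ∈ F₂) : slTransvection hfw ∈ flagStabilizer hle := by
  refine mem_flagStabilizer.mpr ⟨fun v hv => ?_, fun v hv => ?_⟩
  · rw [slTransvection_apply]
    exact F₁.add_mem hv (h₁ v hv)
  · rw [slTransvection_apply]
    exact F₂.add_mem hv (h₂ v hv)

/-- Transvections whose form kills a member of the flag and whose vector lies in that member
stabilize the whole flag, so each member can be recovered from the stabilizer. -/
theorem eq_of_flagStabilizer_le {F₁ F₂ F₁' F₂' : Submodule ℂ E} (hF : IsFlag F₁ F₂)
    (hF' : IsFlag F₁' F₂') (h : flagStabilizer hF.2.2 ≤ flagStabilizer hF'.2.2) :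
    F₁ = F₁' ∧ F₂ = F₂' := by
  constructor
  · refine (by_contra fun hne => ?_ : F₁ = F₁')
    have hn : ¬ F₁' ≤ F₁ := fun hle =>
      hne (Submodule.eq_of_le_of_finrank_eq hle (by rw [hF.1, hF'.1])).symm
    refine hne (Submodule.eq_of_le_of_finrank_eq (le_of_forall_transvection_mem hn ?_)
      (by rw [hF.1, hF'.1]))
    intro f w hfw hf hw
    refine (mem_flagStabilizer.mp (h (slTransvection_mem_flagStabilizer hfw ?_ ?_))).1
    · exact fun v hv => F₁.smul_mem _ hw
    · exact fun v hv => F₂.smul_mem _ (hF.2.2 hw)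
  · refine (by_contra fun hne => ?_ : F₂ = F₂')
    have hn : ¬ F₂' ≤ F₂ := fun hle =>
      hne (Submodule.eq_of_le_of_finrank_eq hle (by rw [hF.2.1, hF'.2.1])).symm
    refine hne (Submodule.eq_of_le_of_finrank_eq (le_of_forall_transvection_mem hn ?_)
      (by rw [hF.2.1, hF'.2.1]))
    intro f w hfw hf hw
    refine (mem_flagStabilizer.mp (h (slTransvection_mem_flagStabilizer hfw ?_ ?_))).2
    · intro v hv
      rw [hf v (hF.2.2 hv), zero_smul]
      exact F₁.zero_mem
    · exact fun v hv => F₂.smul_mem _ hw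

/-- The Borel subgroups of `SL(E)`, `dim E = 3`, are the stabilizers of full flags. -/
theorem isBorel_iff (hE : Module.finrank ℂ E = 3) {B : Subgroup (SpecialLinearGroup ℂ E)} :
    IsBorel B ↔ ∃ (F₁ F₂ : Submodule ℂ E) (h : IsFlag F₁ F₂), B = flagStabilizer h.2.2 := by
  have hccs : ∀ {F₁ F₂ : Submodule ℂ E} (h : IsFlag F₁ F₂),
      IsClosedConnectedSolvable (flagStabilizer h.2.2) := by
    intro F₁ F₂ h
    obtain ⟨b, hb⟩ := h.exists_adapted hE
    exact ⟨hb.isClosed_flagStabilizer, hb.isConnected_flagStabilizer,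
      hb.isSolvable_flagStabilizer⟩
  have hle : ∀ {H : Subgroup (SpecialLinearGroup ℂ E)}, IsClosedConnectedSolvable H →
      ∃ (F₁ F₂ : Submodule ℂ E) (h : IsFlag F₁ F₂), H ≤ flagStabilizer h.2.2 := by
    intro H hH
    obtain ⟨F₁, F₂, h₁, h₂, h, hi₁, hi₂⟩ := exists_invariant_flag hE hH.2.1 hH.2.2
    exact ⟨F₁, F₂, ⟨h₁, h₂, h⟩, fun g hg => mem_flagStabilizer.mpr ⟨hi₁ g hg, hi₂ g hg⟩⟩
  constructor
  · intro hB
    obtain ⟨F₁, F₂, h, hBle⟩ := hle hB.prop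
    exact ⟨F₁, F₂, h, hB.eq_of_le (hccs h) hBle⟩
  · rintro ⟨F₁, F₂, h, rfl⟩
    -- Any larger group of this kind fixes a flag as well; the two stabilizers are then nested, so
    -- the flags coincide.
    refine ⟨hccs h, fun H hH hBH => ?_⟩
    obtain ⟨F₁', F₂', h', hHle⟩ := hle hH
    obtain ⟨rfl, rfl⟩ := eq_of_flagStabilizer_le h h' (le_trans hBH hHle)
    exact hHle

end Borel

end Flags

/-! ### Criteria for smoothness and singularity of coordinate rings -/

section SmoothnessCriteria

variable {V : Type*} [AddCommGroup V] [Module ℂ V]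

/-- A subset of affine space which is the image of a polynomial map with a linear retraction has
a polynomial ring as its coordinate ring. -/
theorem smooth_coordinateRing_of_parametrization {ι : Type*} [Finite ι] {Z : Set V}
    (γ : (ι → ℂ) → V) (l : ι → Module.Dual ℂ V) (hγ : ∀ t, γ t ∈ Z)
    (hl : ∀ t i, l i (γ t) = t i) (hZ : ∀ z ∈ Z, γ (fun i => l i z) = z)
    (hpoly : ∀ φ : Module.Dual ℂ V, ∃ p : MvPolynomial ι ℂ,
      ∀ t, φ (γ t) = MvPolynomial.eval t p) :
    Algebra.Smooth ℂ (coordinateRing Z) := by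
  let Φ : MvPolynomial ι ℂ →ₐ[ℂ] (Z → ℂ) := MvPolynomial.aeval fun i (z : Z) => l i (z : V)
  have hΦ : ∀ p (z : Z), Φ p z = MvPolynomial.eval (fun i => l i (z : V)) p := by
    intro p z
    have : (Pi.evalAlgHom ℂ (fun _ : Z => ℂ) z).comp Φ =
        MvPolynomial.aeval (fun i => l i (z : V)) := by
      ext i
      simp [Φ]
    exact DFunLike.congr_fun this p
  have hinj : Function.Injective Φ := by
    intro p q hpq
    refine MvPolynomial.funext fun t => ?_
    have := congrFun hpq ⟨γ t, hγ t⟩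
    simpa only [hΦ, hl] using this
  have hrange : Φ.range = coordinateRing Z := by
    apply le_antisymm
    · rintro _ ⟨p, rfl⟩
      refine ⟨MvPolynomial.rename l p, ?_⟩
      change MvPolynomial.aeval _ (MvPolynomial.rename l p) = _
      rw [MvPolynomial.aeval_rename]
      rfl
    · rw [coordinateRing, ← Algebra.adjoin_range_eq_range_aeval, Algebra.adjoin_le_iff]
      rintro _ ⟨φ, rfl⟩
      obtain ⟨p, hp⟩ := hpoly φ
      refine ⟨p, ?_⟩
      funext z
      change Φ p z = _
      rw [hΦ, ← hp, hZ z z.2]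
  have e : MvPolynomial ι ℂ ≃ₐ[ℂ] coordinateRing Z :=
    (AlgEquiv.ofInjective Φ hinj).trans (Subalgebra.equivOfEq _ _ hrange)
  have : Algebra.Smooth ℂ (MvPolynomial ι ℂ) := {}
  exact Algebra.Smooth.of_equiv e

open Polynomial in
/-- Restriction of polynomial functions on `V` to the parametrised line `w + X u`. -/
def lineRestriction (w u : V) : MvPolynomial (Module.Dual ℂ V) ℂ →ₐ[ℂ] Polynomial ℂ :=
  MvPolynomial.aeval fun φ => C (φ w) + C (φ u) * X

open Polynomial in
theorem lineRestriction_X (w u : V) (φ : Module.Dual ℂ V) :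
    lineRestriction w u (MvPolynomial.X φ) = C (φ w) + C (φ u) * X :=
  MvPolynomial.aeval_X _ _

open Polynomial in
theorem eval_lineRestriction (w u : V) (P : MvPolynomial (Module.Dual ℂ V) ℂ) (t : ℂ) :
    (lineRestriction w u P).eval t = polyEval V P (w + t • u) := by
  have : (Polynomial.aeval t).comp (lineRestriction w u) =
      MvPolynomial.aeval (fun φ : Module.Dual ℂ V => φ (w + t • u)) := by
    ext φ
    change Polynomial.aeval t (lineRestriction w u (MvPolynomial.X φ)) = _
    rw [lineRestriction_X, MvPolynomial.aeval_X, map_add φ, map_smul φ]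
    simp only [map_add, map_mul, Polynomial.aeval_C, Polynomial.aeval_X, smul_eq_mul]
    exact congrArg _ (mul_comm _ _)
  exact DFunLike.congr_fun this P

open Polynomial in
-- First-order Taylor expansion at `w`: the constant term does not see the direction, and the linear
-- coefficient is a derivative, hence additive in the direction.
theorem coeff_lineRestriction_add (w u₁ u₂ : V) (P : MvPolynomial (Module.Dual ℂ V) ℂ) :
    (lineRestriction w (u₁ + u₂) P).coeff 0 = (lineRestriction w u₁ P).coeff 0 ∧
    (lineRestriction w u₂ P).coeff 0 = (lineRestriction w u₁ P).coeff 0 ∧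
    (lineRestriction w (u₁ + u₂) P).coeff 1 =
      (lineRestriction w u₁ P).coeff 1 + (lineRestriction w u₂ P).coeff 1 := by
  induction P using MvPolynomial.induction_on with
  | C a => simp [lineRestriction, coeff_C, Polynomial.algebraMap_eq]
  | add p q hp hq =>
    simp only [map_add, coeff_add, hp, hq, true_and]
    ring
  | mul_X p φ hp =>
    obtain ⟨h1, h2, h3⟩ := hp
    have c0 : ∀ (q : ℂ[X]) (a b : ℂ), (q * (C a + C b * X)).coeff 0 = q.coeff 0 * a := by
      intro q a b
      simp [mul_coeff_zero]
    have c1 : ∀ (q : ℂ[X]) (a b : ℂ),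
        (q * (C a + C b * X)).coeff 1 = q.coeff 1 * a + q.coeff 0 * b := by
      intro q a b
      rw [mul_add, coeff_add, coeff_mul_C, ← mul_assoc, coeff_mul_X, coeff_mul_C]
    simp only [map_mul, lineRestriction_X, c0, c1, h1, h2, h3, true_and]
    rw [map_add]
    ring

theorem exists_lift_of_sq_zero {A B C : Type*} [CommRing A] [CommRing B] [CommRing C]
    [Algebra ℂ A] [Algebra ℂ B] [Algebra ℂ C] [Algebra.FormallySmooth ℂ A] (f : A →ₐ[ℂ] C)
    (g : B →ₐ[ℂ] C) (hg : Function.Surjective g) (h : ∀ r s, g r = 0 → g s = 0 → r * s = 0) :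
    ∃ L : A →ₐ[ℂ] B, ∀ x, g (L x) = f x := by
  have hker : IsNilpotent (RingHom.ker (g : B →+* C)) := by
    refine ⟨2, ?_⟩
    rw [pow_two, Ideal.zero_eq_bot, eq_bot_iff, Ideal.mul_le]
    exact fun r hr s hs => h r s hr hs
  exact ⟨Algebra.FormallySmooth.liftOfSurjective f g hg hker,
    Algebra.FormallySmooth.liftOfSurjective_apply f g hg hker⟩

open Polynomial in
/-- The vertex of a quadric cone is a singular point: the tangent vector `u₁ + u₂` does not lift
to second order, although it is a sum of two tangent vectors integrating to lines. -/
theorem not_smooth_coordinateRing {Z : Set V} {w u₁ u₂ : V} (h₁ : ∀ t : ℂ, w + t • u₁ ∈ Z)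
    (h₂ : ∀ t : ℂ, w + t • u₂ ∈ Z) (x₁ y₁ x₂ y₂ : Module.Dual ℂ V)
    (hx₁ : x₁ w = 0) (hy₁ : y₁ w = 0) (hx₂ : x₂ w = 0) (hy₂ : y₂ w = 0)
    (hZ : ∀ z ∈ Z, x₁ z * y₁ z + x₂ z * y₂ z = 0)
    (hu : x₁ (u₁ + u₂) * y₁ (u₁ + u₂) + x₂ (u₁ + u₂) * y₂ (u₁ + u₂) ≠ 0) :
    ¬ Algebra.Smooth ℂ (coordinateRing Z) := by
  intro hsm
  have hfs : Algebra.FormallySmooth ℂ (coordinateRing Z) := hsm.formallySmooth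
  let F : MvPolynomial (Module.Dual ℂ V) ℂ →ₐ[ℂ] (Z → ℂ) :=
    MvPolynomial.aeval (R := ℂ) (fun (φ : Module.Dual ℂ V) (z : Z) => φ (z : V))
  have hF : ∀ P (z : Z), F P z = polyEval V P z := by
    intro P z
    have : (Pi.evalAlgHom ℂ (fun _ : Z => ℂ) z).comp F =
        MvPolynomial.aeval (fun φ : Module.Dual ℂ V => φ (z : V)) := by
      ext i
      simp [F]
    exact DFunLike.congr_fun this P
  let u := u₁ + u₂
  let I : ℕ → Ideal ℂ[X] := fun n => Ideal.span {X ^ n}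
  have hline : ∀ v, (∀ t : ℂ, w + t • v ∈ Z) → ∀ P, F P = 0 → lineRestriction w v P = 0 := by
    intro v hv P hP
    refine Polynomial.funext fun t => ?_
    rw [eval_lineRestriction, eval_zero]
    have := congrFun hP ⟨_, hv t⟩
    rwa [hF] at this
  -- The tangent vector `u` gives a homomorphism to `ℂ[X]/X²`. It is well defined because a
  -- polynomial vanishing on `Z` vanishes on both lines, so by additivity its restriction along `u`
  -- has no terms of degree 0 or 1.
  let f : coordinateRing Z →ₐ[ℂ] ℂ[X] ⧸ I 2 :=
    AlgHom.liftOfSurjective F.rangeRestrict F.rangeRestrict_surjective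
      ((Ideal.Quotient.mkₐ ℂ (I 2)).comp (lineRestriction w u)) (by
        intro P hP
        have hP' : F P = 0 := congrArg Subtype.val hP
        obtain ⟨c0, -, c1⟩ := coeff_lineRestriction_add w u₁ u₂ P
        rw [hline u₁ h₁ P hP', coeff_zero] at c0
        rw [hline u₁ h₁ P hP', hline u₂ h₂ P hP', coeff_zero, add_zero] at c1
        rw [RingHom.mem_ker]
        change Ideal.Quotient.mk (I 2) (lineRestriction w u P) = 0
        rw [Ideal.Quotient.eq_zero_iff_mem, Ideal.mem_span_singleton, X_pow_dvd_iff]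
        intro d hd
        interval_cases d
        · exact c0
        · exact c1)
  have hle : I 3 ≤ I 2 := by
    rw [Ideal.span_singleton_le_span_singleton]
    exact pow_dvd_pow _ (by norm_num)
  let g : ℂ[X] ⧸ I 3 →ₐ[ℂ] ℂ[X] ⧸ I 2 := Ideal.Quotient.factorₐ ℂ hle
  have hgmk : ∀ p, g (Ideal.Quotient.mk (I 3) p) = Ideal.Quotient.mk (I 2) p := fun p => rfl
  have hg : Function.Surjective g := Ideal.Quotient.factor_surjective hle
  have hker : ∀ r s, g r = 0 → g s = 0 → r * s = 0 := by
    intro r s hr hs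
    obtain ⟨p, rfl⟩ := Ideal.Quotient.mk_surjective r
    obtain ⟨q, rfl⟩ := Ideal.Quotient.mk_surjective s
    have hp : Ideal.Quotient.mk (I 2) p = 0 := hr
    have hq : Ideal.Quotient.mk (I 2) q = 0 := hs
    rw [Ideal.Quotient.eq_zero_iff_mem, Ideal.mem_span_singleton] at hp hq
    rw [← map_mul, Ideal.Quotient.eq_zero_iff_mem, Ideal.mem_span_singleton]
    refine dvd_trans (pow_dvd_pow X (by norm_num : 3 ≤ 2 + 2)) ?_
    rw [pow_add]
    exact mul_dvd_mul hp hq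
  obtain ⟨L, hLf⟩ := exists_lift_of_sq_zero f g hg hker
  have hL : ∀ l : Module.Dual ℂ V, l w = 0 → ∃ r : ℂ[X],
      L (F.rangeRestrict (MvPolynomial.X l)) =
        Ideal.Quotient.mk (I 3) (C (l u) * X + X ^ 2 * r) := by
    intro l hl
    obtain ⟨p, hp⟩ := Ideal.Quotient.mk_surjective (L (F.rangeRestrict (MvPolynomial.X l)))
    have e1 : g (L (F.rangeRestrict (MvPolynomial.X l))) =
        Ideal.Quotient.mk (I 2) (C (l u) * X) := by
      rw [hLf, AlgHom.liftOfSurjective_apply]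
      change Ideal.Quotient.mk (I 2) (lineRestriction w u (MvPolynomial.X l)) = _
      rw [lineRestriction_X, hl, map_zero, zero_add]
    rw [← hp, hgmk, Ideal.Quotient.eq, Ideal.mem_span_singleton] at e1
    obtain ⟨r, hr⟩ := e1
    refine ⟨r, ?_⟩
    rw [← hp, ← hr]
    congr 1
    ring
  obtain ⟨p₁, hp₁⟩ := hL x₁ hx₁
  obtain ⟨q₁, hq₁⟩ := hL y₁ hy₁
  obtain ⟨p₂, hp₂⟩ := hL x₂ hx₂
  obtain ⟨q₂, hq₂⟩ := hL y₂ hy₂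
  have hrel : F.rangeRestrict (MvPolynomial.X x₁) * F.rangeRestrict (MvPolynomial.X y₁) +
      F.rangeRestrict (MvPolynomial.X x₂) * F.rangeRestrict (MvPolynomial.X y₂) = 0 := by
    apply Subtype.ext
    funext z
    have := hZ z z.2
    simpa [F] using this
  have hrel' := congrArg L hrel
  rw [map_add, map_mul, map_mul, hp₁, hq₁, hp₂, hq₂, map_zero, ← map_mul, ← map_mul, ← map_add,
    Ideal.Quotient.eq_zero_iff_mem, Ideal.mem_span_singleton, X_pow_dvd_iff] at hrel'
  -- The lift `L` to `ℂ[X]/X³` must satisfy the quadratic relation. Its `X²` coefficient depends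
  -- only on the linear terms of the lift and is the quadratic form at `u`, nonzero by `hu`.
  have h2 := hrel' 2 (by norm_num)
  have e : (C (x₁ u) * X + X ^ 2 * p₁) * (C (y₁ u) * X + X ^ 2 * q₁) +
      (C (x₂ u) * X + X ^ 2 * p₂) * (C (y₂ u) * X + X ^ 2 * q₂) =
      C (x₁ u * y₁ u + x₂ u * y₂ u) * X ^ 2 + (C (x₁ u) * q₁ + C (y₁ u) * p₁ + C (x₂ u) * q₂ +
        C (y₂ u) * p₂ + X * (p₁ * q₁ + p₂ * q₂)) * X ^ 3 := by
    simp only [map_add, map_mul]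
    ring
  rw [e, coeff_add, coeff_C_mul, coeff_X_pow_self, coeff_mul_X_pow', if_neg (by norm_num),
    add_zero, mul_one] at h2
  exact hu h2

end SmoothnessCriteria

/-! ### Smoothness of projective subspaces and of the quadric -/

section SmoothVarieties

variable {V : Type*} [AddCommGroup V] [Module ℂ V]

theorem mk_mem_projSubspace {W : Submodule ℂ V} {v : V} (hv : v ≠ 0) :
    Projectivization.mk ℂ v hv ∈ projSubspace W ↔ v ∈ W := by
  change (Projectivization.mk ℂ v hv).submodule ≤ W ↔ _
  rw [Projectivization.submodule_mk, Submodule.span_singleton_le_iff_mem]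

theorem exists_dual_eq_one {v : V} (hv : v ≠ 0) : ∃ φ : Module.Dual ℂ V, φ v = 1 := by
  obtain ⟨φ, hφ⟩ := Module.Projective.exists_dual_ne_zero ℂ hv
  exact ⟨(φ v)⁻¹ • φ, by simp [hφ]⟩

theorem isSmoothVariety_projSubspace [FiniteDimensional ℂ V] (W : Submodule ℂ V) :
    IsSmoothVariety (projSubspace W) := by
  intro x hx
  set w := x.rep with hw
  have hwW : w ∈ W := by
    rw [← mk_mem_projSubspace x.rep_nonzero, Projectivization.mk_rep]
    exact hx
  obtain ⟨φ, hφ⟩ : ∃ φ : Module.Dual ℂ V, φ w = 1 := exists_dual_eq_one x.rep_nonzero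
  refine ⟨φ, by rw [hφ]; exact one_ne_zero, ?_⟩
  let K : Submodule ℂ V := LinearMap.ker φ ⊓ W
  let c := Module.finBasis ℂ K
  obtain ⟨π, hπ⟩ := K.subtype.exists_leftInverse_of_injective K.ker_subtype
  have hπ' : ∀ k : K, π k = k := fun k => LinearMap.congr_fun hπ k
  -- The chart is the affine space through `w` with direction `ker φ ⊓ W`. Since `φ = 1` there,
  -- subtracting a multiple of `φ` turns the affine coordinates centred at `w` into linear forms on
  -- `V`.
  refine smooth_coordinateRing_of_parametrization
    (fun t => w + ∑ i, t i • (c i : V))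
    (fun i => (c.coord i).comp π - c.coord i (π w) • φ) ?_ ?_ ?_ ?_
  · intro t
    have hsum : ∑ i, t i • (c i : V) ∈ K := K.sum_mem fun i _ => K.smul_mem _ (c i).2
    have h1 : φ (w + ∑ i, t i • (c i : V)) = 1 := by
      rw [map_add, hφ, LinearMap.mem_ker.mp hsum.1, add_zero]
    have hne : w + ∑ i, t i • (c i : V) ≠ 0 := by
      intro h0
      rw [h0, map_zero] at h1
      exact zero_ne_one h1
    exact ⟨h1, hne, (mk_mem_projSubspace hne).mpr (W.add_mem hwW hsum.2)⟩
  · intro t i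
    have hsum : ∑ i, t i • (c i : V) = ((∑ i, t i • c i : K) : V) := by simp
    have hk : φ ((∑ i, t i • c i : K) : V) = 0 := LinearMap.mem_ker.mp (∑ i, t i • c i : K).2.1
    rw [hsum]
    simp only [LinearMap.sub_apply, LinearMap.comp_apply, LinearMap.smul_apply, map_add, hπ', hφ,
      hk, smul_eq_mul, mul_one]
    simp [Finsupp.single_apply]
  · rintro z ⟨hz1, hz0, hz⟩
    rw [mk_mem_projSubspace] at hz
    have hk : z - w ∈ K := ⟨LinearMap.mem_ker.mpr (by rw [map_sub, hz1, hφ, sub_self]),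
      W.sub_mem hz hwW⟩
    have h1 : ∀ i, ((c.coord i).comp π - c.coord i (π w) • φ) z = c.coord i ⟨z - w, hk⟩ := by
      intro i
      rw [← hπ' ⟨z - w, hk⟩]
      simp [hz1]
    simp only [h1]
    have := congrArg Subtype.val (c.sum_repr ⟨z - w, hk⟩)
    rw [Submodule.coe_sum] at this
    simp only [Submodule.coe_smul] at this
    simp only [Module.Basis.coord_apply]
    rw [this, add_sub_cancel]
  · intro ψ
    exact ⟨MvPolynomial.C (ψ w) + ∑ i, MvPolynomial.C (ψ (c i)) * MvPolynomial.X i,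
      fun t => by simp [mul_comm]⟩

variable {E : Type*} [AddCommGroup E] [Module ℂ E]

theorem mk_mem_quadric {v : E × Module.Dual ℂ E} (hv : v ≠ 0) :
    Projectivization.mk ℂ v hv ∈ quadric E ↔ v.2 v.1 = 0 := by
  obtain ⟨a, ha⟩ := Projectivization.exists_smul_eq_mk_rep ℂ v hv
  change (Projectivization.mk ℂ v hv).rep.2 (Projectivization.mk ℂ v hv).rep.1 = 0 ↔ _
  rw [← ha]
  simp [Units.smul_def]

theorem dual_apply_eq (b : Module.Basis (Fin 3) ℂ E) (f : Module.Dual ℂ E) (e : E) :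
    f e = f (b 0) * b.coord 0 e + f (b 1) * b.coord 1 e + f (b 2) * b.coord 2 e := by
  conv_lhs => rw [sum_coord_smul b e]
  simp only [map_add, map_smul, smul_eq_mul]
  ring

theorem dual_eq_sum (b : Module.Basis (Fin 3) ℂ E) (f : Module.Dual ℂ E) :
    f = f (b 0) • b.coord 0 + f (b 1) • b.coord 1 + f (b 2) • b.coord 2 := by
  ext e
  simpa using dual_apply_eq b f e

theorem dual_pair_apply (φ : Module.Dual ℂ (E × Module.Dual ℂ E)) (e : E)
    (f : Module.Dual ℂ E) : φ (e, f) = φ (e, 0) + φ (0, f) := by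
  rw [← map_add]
  simp

/-- Where the coordinate of `e` along `b 0` is 1, the equation `f e = 0` can be solved for `f (b
0)`: the chart is the graph of a polynomial on `ℂ⁴`. -/
theorem smooth_quadric_chart_fst (b : Module.Basis (Fin 3) ℂ E) :
    Algebra.Smooth ℂ (coordinateRing (affineChart (quadric E)
      ((b.coord 0).comp (LinearMap.fst ℂ E (Module.Dual ℂ E))))) := by
  let ev : E → Module.Dual ℂ (E × Module.Dual ℂ E) := fun v =>
    (Module.Dual.eval ℂ E v).comp (LinearMap.snd ℂ E (Module.Dual ℂ E))
  let co : Fin 3 → Module.Dual ℂ (E × Module.Dual ℂ E) := fun i =>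
    (b.coord i).comp (LinearMap.fst ℂ E (Module.Dual ℂ E))
  refine smooth_coordinateRing_of_parametrization (ι := Fin 4)
    (fun t => (b 0 + t 0 • b 1 + t 1 • b 2,
      t 2 • b.coord 1 + t 3 • b.coord 2 - (t 0 * t 2 + t 1 * t 3) • b.coord 0))
    ![co 1, co 2, ev (b 1), ev (b 2)] ?_ ?_ ?_ ?_
  · intro t
    refine ⟨by simp, ?_⟩
    have hne : ((b 0 + t 0 • b 1 + t 1 • b 2,
      t 2 • b.coord 1 + t 3 • b.coord 2 - (t 0 * t 2 + t 1 * t 3) • b.coord 0) :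
        E × Module.Dual ℂ E) ≠ 0 := by
      intro h0
      have := congrArg (fun v : E × Module.Dual ℂ E => b.coord 0 v.1) h0
      simp at this
    refine ⟨hne, (mk_mem_quadric hne).mpr ?_⟩
    simp
    ring
  · intro t i
    fin_cases i <;> simp [co, ev]
  · rintro ⟨e, f⟩ ⟨h1, h0, hq⟩
    rw [mk_mem_quadric] at hq
    have h1' : b.coord 0 e = 1 := h1
    have hq' : f e = 0 := hq
    rw [dual_apply_eq b, h1'] at hq'
    refine Prod.ext ?_ ?_
    · conv_rhs => rw [sum_coord_smul b e, h1', one_smul]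
      rfl
    · conv_rhs => rw [dual_eq_sum b f]
      have h2 : -(b.coord 1 e * f (b 1) + b.coord 2 e * f (b 2)) = f (b 0) := by
        linear_combination -hq'
      rw [← h2]
      change f (b 1) • b.coord 1 + f (b 2) • b.coord 2 -
        (b.coord 1 e * f (b 1) + b.coord 2 e * f (b 2)) • b.coord 0 = _
      module
  · intro φ
    open MvPolynomial in
    refine ⟨C (φ (b 0, 0)) + X 0 * C (φ (b 1, 0)) + X 1 * C (φ (b 2, 0)) +
      X 2 * C (φ (0, b.coord 1)) + X 3 * C (φ (0, b.coord 2)) -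
      (X 0 * X 2 + X 1 * X 3) * C (φ (0, b.coord 0)), fun t => ?_⟩
    rw [dual_pair_apply]
    have e1 : φ (b 0 + t 0 • b 1 + t 1 • b 2, 0) =
        φ ((b 0, 0) + t 0 • (b 1, 0) + t 1 • (b 2, 0)) := by simp
    have e2 : φ (0, t 2 • b.coord 1 + t 3 • b.coord 2 - (t 0 * t 2 + t 1 * t 3) • b.coord 0) =
        φ (t 2 • (0, b.coord 1) + t 3 • (0, b.coord 2) -
          (t 0 * t 2 + t 1 * t 3) • (0, b.coord 0)) := by simp
    rw [e1, e2]
    simp only [map_add, map_sub, map_smul, map_mul, smul_eq_mul, MvPolynomial.eval_C,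
      MvPolynomial.eval_X]
    ring

theorem smooth_quadric_chart_snd (b : Module.Basis (Fin 3) ℂ E) :
    Algebra.Smooth ℂ (coordinateRing (affineChart (quadric E)
      ((Module.Dual.eval ℂ E (b 0)).comp (LinearMap.snd ℂ E (Module.Dual ℂ E))))) := by
  let ev : E → Module.Dual ℂ (E × Module.Dual ℂ E) := fun v =>
    (Module.Dual.eval ℂ E v).comp (LinearMap.snd ℂ E (Module.Dual ℂ E))
  let co : Fin 3 → Module.Dual ℂ (E × Module.Dual ℂ E) := fun i =>
    (b.coord i).comp (LinearMap.fst ℂ E (Module.Dual ℂ E))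
  refine smooth_coordinateRing_of_parametrization (ι := Fin 4)
    (fun t => (t 2 • b 1 + t 3 • b 2 - (t 0 * t 2 + t 1 * t 3) • b 0,
      b.coord 0 + t 0 • b.coord 1 + t 1 • b.coord 2))
    ![ev (b 1), ev (b 2), co 1, co 2] ?_ ?_ ?_ ?_
  · intro t
    refine ⟨by simp, ?_⟩
    have hne : ((t 2 • b 1 + t 3 • b 2 - (t 0 * t 2 + t 1 * t 3) • b 0,
      b.coord 0 + t 0 • b.coord 1 + t 1 • b.coord 2) : E × Module.Dual ℂ E) ≠ 0 := by
      intro h0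
      have := congrArg (fun v : E × Module.Dual ℂ E => v.2 (b 0)) h0
      simp at this
    refine ⟨hne, (mk_mem_quadric hne).mpr ?_⟩
    simp
  · intro t i
    fin_cases i <;> simp [co, ev]
  · rintro ⟨e, f⟩ ⟨h1, h0, hq⟩
    rw [mk_mem_quadric] at hq
    have h1' : f (b 0) = 1 := h1
    have hq' : f e = 0 := hq
    rw [dual_apply_eq b, h1'] at hq'
    refine Prod.ext ?_ ?_
    · conv_rhs => rw [sum_coord_smul b e]
      have h2 : -(f (b 1) * b.coord 1 e + f (b 2) * b.coord 2 e) = b.coord 0 e := by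
        linear_combination -hq'
      rw [← h2]
      change b.coord 1 e • b 1 + b.coord 2 e • b 2 -
        (f (b 1) * b.coord 1 e + f (b 2) * b.coord 2 e) • b 0 = _
      module
    · conv_rhs => rw [dual_eq_sum b f, h1', one_smul]
      rfl
  · intro φ
    open MvPolynomial in
    refine ⟨C (φ (0, b.coord 0)) + X 0 * C (φ (0, b.coord 1)) + X 1 * C (φ (0, b.coord 2)) +
      X 2 * C (φ (b 1, 0)) + X 3 * C (φ (b 2, 0)) -
      (X 0 * X 2 + X 1 * X 3) * C (φ (b 0, 0)), fun t => ?_⟩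
    rw [dual_pair_apply]
    have e1 : φ (t 2 • b 1 + t 3 • b 2 - (t 0 * t 2 + t 1 * t 3) • b 0, 0) =
        φ (t 2 • (b 1, 0) + t 3 • (b 2, 0) - (t 0 * t 2 + t 1 * t 3) • (b 0, 0)) := by simp
    have e2 : φ (0, b.coord 0 + t 0 • b.coord 1 + t 1 • b.coord 2) =
        φ ((0, b.coord 0) + t 0 • (0, b.coord 1) + t 1 • (0, b.coord 2)) := by simp
    rw [e1, e2]
    simp only [map_add, map_sub, map_smul, map_mul, smul_eq_mul, MvPolynomial.eval_C,
      MvPolynomial.eval_X]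
    ring

theorem isSmoothVariety_quadric (b : Module.Basis (Fin 3) ℂ E) :
    IsSmoothVariety (quadric E) := by
  intro x _
  by_cases he : x.rep.1 = 0
  · have hf : x.rep.2 ≠ 0 := fun hf => x.rep_nonzero (Prod.ext he hf)
    obtain ⟨i, hi⟩ : ∃ i, x.rep.2 (b i) ≠ 0 := by
      by_contra! h
      exact hf (b.ext h)
    refine ⟨_, ?_, smooth_quadric_chart_snd (b.reindex (Equiv.swap i 0))⟩
    simpa using hi
  · obtain ⟨i, hi⟩ : ∃ i, b.coord i x.rep.1 ≠ 0 := by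
      by_contra! h
      exact he (b.ext_elem (by simpa using h))
    refine ⟨_, ?_, smooth_quadric_chart_fst (b.reindex (Equiv.swap i 0))⟩
    simpa using hi

end SmoothVarieties

/-! ### Zariski closures along lines -/

section ProjectiveZariski

variable {V : Type*} [AddCommGroup V] [Module ℂ V]

theorem polyEval_smul {d : ℕ} {P : MvPolynomial (Module.Dual ℂ V) ℂ} (hP : P.IsHomogeneous d)
    (c : ℂ) (v : V) : polyEval V P (c • v) = c ^ d * polyEval V P v := by
  simp only [polyEval, MvPolynomial.eval_eq, Finset.mul_sum, map_smul, smul_eq_mul]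
  refine Finset.sum_congr rfl fun m hm => ?_
  have hm' : ∑ φ ∈ m.support, m φ = d := by
    rw [← Finsupp.degree_apply, Finsupp.degree_eq_weight_one]
    exact hP (MvPolynomial.mem_support_iff.mp hm)
  simp only [mul_pow]
  rw [Finset.prod_mul_distrib, Finset.prod_pow_eq_pow_sum, hm']
  ring

theorem polyEval_rep_ne_zero {d : ℕ} {P : MvPolynomial (Module.Dual ℂ V) ℂ}
    (hP : P.IsHomogeneous d) {v : V} (hv : v ≠ 0) :
    polyEval V P (Projectivization.mk ℂ v hv).rep ≠ 0 ↔ polyEval V P v ≠ 0 := by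
  obtain ⟨a, ha⟩ := Projectivization.exists_smul_eq_mk_rep ℂ v hv
  rw [← ha, Units.smul_def, polyEval_smul hP, mul_ne_zero_iff]
  exact and_iff_right (pow_ne_zero _ a.ne_zero)

theorem isOpen_nonvanishing {d : ℕ} {P : MvPolynomial (Module.Dual ℂ V) ℂ}
    (hP : P.IsHomogeneous d) : IsOpen[projZariski V] {x : ℙ ℂ V | polyEval V P x.rep ≠ 0} :=
  TopologicalSpace.isOpen_generateFrom_of_mem ⟨d, P, hP, rfl⟩

theorem isClosed_vanishing {d : ℕ} {P : MvPolynomial (Module.Dual ℂ V) ℂ}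
    (hP : P.IsHomogeneous d) : IsClosed[projZariski V] {x : ℙ ℂ V | polyEval V P x.rep = 0} := by
  let := projZariski V
  rw [← isOpen_compl_iff]
  exact isOpen_nonvanishing hP

theorem isOpen_linear_ne_zero (φ : Module.Dual ℂ V) :
    IsOpen[projZariski V] {x : ℙ ℂ V | φ x.rep ≠ 0} := by
  simpa [polyEval] using isOpen_nonvanishing (MvPolynomial.isHomogeneous_X ℂ φ)

theorem isClosed_linear_eq_zero (φ : Module.Dual ℂ V) :
    IsClosed[projZariski V] {x : ℙ ℂ V | φ x.rep = 0} := by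
  simpa [polyEval] using isClosed_vanishing (MvPolynomial.isHomogeneous_X ℂ φ)

theorem continuous_mk_line (p q : V) (h : ∀ t : ℂ, p + t • q ≠ 0) :
    @Continuous ℂ _ _ (projZariski V) (fun t => Projectivization.mk ℂ (p + t • q) (h t)) := by
  refine continuous_generateFrom_iff.mpr ?_
  rintro _ ⟨d, P, hP, rfl⟩
  have hcont : Continuous fun t : ℂ => polyEval V P (p + t • q) := by
    refine (MvPolynomial.continuous_eval P).comp (continuous_pi fun φ => ?_)
    simp only [map_add, map_smul, smul_eq_mul]
    fun_prop
  convert (isOpen_compl_singleton (x := (0 : ℂ))).preimage hcont using 1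
  ext t
  exact polyEval_rep_ne_zero hP (h t)

/-- The punctured line is dense in `ℂ` for the usual topology, and the line maps continuously to the
Zariski topology. Every degeneration below uses this. -/
theorem mem_closure_of_line {S : Set (ℙ ℂ V)} {p q : V} (h : ∀ t : ℂ, p + t • q ≠ 0)
    (hS : ∀ t : ℂ, t ≠ 0 → Projectivization.mk ℂ (p + t • q) (h t) ∈ S) (hp : p ≠ 0) :
    Projectivization.mk ℂ p hp ∈ closure[projZariski V] S := by
  let := projZariski V
  have h0 : (0 : ℂ) ∈ closure {t : ℂ | t ≠ 0} := (dense_compl_singleton (0 : ℂ)) 0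
  have := map_mem_closure (continuous_mk_line p q h) h0 hS
  simpa using this

end ProjectiveZariski

/-! ### The action on pairs and the open orbit -/

section Action

variable {E : Type*} [AddCommGroup E] [Module ℂ E]

theorem slProjAct_mk (g : SpecialLinearGroup ℂ E) {v : E × Module.Dual ℂ E} (hv : v ≠ 0) :
    slProjAct g (Projectivization.mk ℂ v hv) =
      Projectivization.mk ℂ (slAct g v) (by simpa using hv) :=
  Projectivization.map_mk _ _ _ _

theorem slAct_fst (g : SpecialLinearGroup ℂ E) (v : E × Module.Dual ℂ E) :
    (slAct g v).1 = (g : E ≃ₗ[ℂ] E) v.1 := rfl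

theorem slAct_snd_apply (g : SpecialLinearGroup ℂ E) (v : E × Module.Dual ℂ E) (e : E) :
    (slAct g v).2 e = v.2 ((g : E ≃ₗ[ℂ] E).symm e) := rfl

theorem slAct_pairing (g : SpecialLinearGroup ℂ E) (v : E × Module.Dual ℂ E) :
    (slAct g v).2 (slAct g v).1 = v.2 v.1 := by
  rw [slAct_snd_apply, slAct_fst, LinearEquiv.symm_apply_apply]

theorem slAct_mul_inv (g h : SpecialLinearGroup ℂ E) (v : E × Module.Dual ℂ E) :
    slAct (g * h⁻¹) (slAct h v) = slAct g v := by
  refine Prod.ext ?_ ?_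
  · change (g : E ≃ₗ[ℂ] E) ((h : E ≃ₗ[ℂ] E).symm ((h : E ≃ₗ[ℂ] E) v.1)) = _
    rw [LinearEquiv.symm_apply_apply]
    rfl
  · ext e
    change v.2 ((h : E ≃ₗ[ℂ] E).symm ((h : E ≃ₗ[ℂ] E) ((g : E ≃ₗ[ℂ] E).symm e))) = _
    rw [LinearEquiv.symm_apply_apply]
    rfl

theorem mk_mem_orbitOf {H : Subgroup (SpecialLinearGroup ℂ E)} {v w r : E × Module.Dual ℂ E}
    (hv : v ≠ 0) (hw : w ≠ 0) {g h : SpecialLinearGroup ℂ E} (hg : g ∈ H) (hh : h ∈ H)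
    (hgr : slAct g r = v) (hhr : slAct h r = w) :
    Projectivization.mk ℂ w hw ∈ orbitOf H (Projectivization.mk ℂ v hv) := by
  refine ⟨h * g⁻¹, H.mul_mem hh (H.inv_mem hg), ?_⟩
  subst hgr hhr
  rw [slProjAct_mk]
  congr 1
  exact (slAct_mul_inv h g r).symm

theorem mem_orbitOf_self (H : Subgroup (SpecialLinearGroup ℂ E))
    (x : ℙ ℂ (E × Module.Dual ℂ E)) : x ∈ orbitOf H x := by
  obtain ⟨v, hv, rfl⟩ : ∃ v, ∃ hv : v ≠ 0, x = Projectivization.mk ℂ v hv :=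
    ⟨x.rep, x.rep_nonzero, x.mk_rep.symm⟩
  exact mk_mem_orbitOf hv hv H.one_mem H.one_mem (r := v) rfl rfl

/-- The points `[e + f]` of the quadric with `e ≠ 0` and `f ≠ 0`. -/
def openOrbit (E : Type*) [AddCommGroup E] [Module ℂ E] : Set (ℙ ℂ (E × Module.Dual ℂ E)) :=
  {x | x.rep.1 ≠ 0 ∧ x.rep.2 ≠ 0 ∧ x.rep.2 x.rep.1 = 0}

theorem mk_mem_openOrbit {v : E × Module.Dual ℂ E} (hv : v ≠ 0) :
    Projectivization.mk ℂ v hv ∈ openOrbit E ↔ v.1 ≠ 0 ∧ v.2 ≠ 0 ∧ v.2 v.1 = 0 := by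
  obtain ⟨a, ha⟩ := Projectivization.exists_smul_eq_mk_rep ℂ v hv
  change (Projectivization.mk ℂ v hv).rep.1 ≠ 0 ∧ (Projectivization.mk ℂ v hv).rep.2 ≠ 0 ∧
    (Projectivization.mk ℂ v hv).rep.2 (Projectivization.mk ℂ v hv).rep.1 = 0 ↔ _
  rw [← ha]
  simp [Units.smul_def]

theorem slProjAct_mem_openOrbit (g : SpecialLinearGroup ℂ E) (x : ℙ ℂ (E × Module.Dual ℂ E)) :
    slProjAct g x ∈ openOrbit E ↔ x ∈ openOrbit E := by
  obtain ⟨v, hv, rfl⟩ : ∃ v, ∃ hv : v ≠ 0, x = Projectivization.mk ℂ v hv :=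
    ⟨x.rep, x.rep_nonzero, x.mk_rep.symm⟩
  rw [slProjAct_mk, mk_mem_openOrbit, mk_mem_openOrbit, slAct_pairing, slAct_fst]
  have h2 : (slAct g v).2 = 0 ↔ v.2 = 0 :=
    (g : E ≃ₗ[ℂ] E).symm.dualMap.map_eq_zero_iff
  rw [Ne, Ne, LinearEquiv.map_eq_zero_iff, h2]

theorem exists_transporting_matrix {i j : Fin 3} (hij : i ≠ j) {x y : Fin 3 → ℂ} (hx : x i ≠ 0)
    (hy : y j ≠ 0) (hxy : y 0 * x 0 + y 1 * x 1 + y 2 * x 2 = 0) :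
    ∃ M : Matrix (Fin 3) (Fin 3) ℂ, M.det = 1 ∧ (∀ r, M r i = x r) ∧
      (∀ c, y 0 * M 0 c + y 1 * M 1 c + y 2 * M 2 c = if c = j then 1 else 0) ∧
      ((∀ k, i < k → x k = 0) → (∀ k, k < j → y k = 0) →
        M 1 0 = 0 ∧ M 2 0 = 0 ∧ M 2 1 = 0) := by
  -- Column `i` is `x`, column `j` is the `j`-th unit vector divided by `y j`, and the remaining
  -- column `c` is a multiple of the `c`-th unit vector corrected along `j` to be killed by `y`. The
  -- factor `y j / x i` makes the determinant 1.
  refine ⟨Matrix.of fun r c => if c = i then x r else if c = j then (if r = j then (y j)⁻¹ else 0)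
    else y j / x i * ((if r = c then 1 else 0) - if r = j then y c / y j else 0), ?_, ?_, ?_, ?_⟩
  · rw [Matrix.det_fin_three]
    fin_cases i <;> fin_cases j <;> simp at hij hx hy ⊢ <;> field_simp
  · intro r
    simp
  · intro c
    fin_cases i <;> fin_cases j <;> fin_cases c <;> simp at hij hx hy ⊢ <;>
      first
      | linear_combination hxy
      | (field_simp; done)
      | (field_simp; ring)
  · intro h1 h2
    have a1 := h1 1
    have a2 := h1 2
    have b0 := h2 0
    have b1 := h2 1
    clear h1 h2
    fin_cases i <;> fin_cases j <;> simp at hij a1 a2 b0 b1 ⊢ <;> simp_all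

/-- This serves both transitivity statements: the first conclusion for `SL(E)`, and the
triangularity clause for the Borel subgroup acting on a cell. -/
theorem exists_slAct_eq (b : Module.Basis (Fin 3) ℂ E) {i j : Fin 3} (hij : i ≠ j)
    {v : E × Module.Dual ℂ E} (hx : b.coord i v.1 ≠ 0) (hy : v.2 (b j) ≠ 0)
    (hv : v.2 v.1 = 0) :
    ∃ g : SpecialLinearGroup ℂ E, slAct g (b i, b.coord j) = v ∧
      ((∀ k, i < k → b.coord k v.1 = 0) → (∀ k, k < j → v.2 (b k) = 0) →
        b.coord 1 ((g : E ≃ₗ[ℂ] E) (b 0)) = 0 ∧ b.coord 2 ((g : E ≃ₗ[ℂ] E) (b 0)) = 0 ∧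
          b.coord 2 ((g : E ≃ₗ[ℂ] E) (b 1)) = 0) := by
  obtain ⟨M, hdet, hcol, hrow, htri⟩ := exists_transporting_matrix (x := fun k => b.coord k v.1)
    (y := fun k => v.2 (b k)) hij hx hy (by rw [← dual_apply_eq b, hv])
  refine ⟨slOfMatrix b M hdet, Prod.ext ?_ ?_, ?_⟩
  · rw [slAct_fst]
    refine b.ext_elem fun r => ?_
    exact (coord_slOfMatrix b M hdet r i).trans (hcol r)
  · ext e
    rw [slAct_snd_apply]
    obtain ⟨e, rfl⟩ := (slOfMatrix b M hdet : E ≃ₗ[ℂ] E).surjective e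
    rw [LinearEquiv.symm_apply_apply]
    have : b.coord j = v.2 ∘ₗ ((slOfMatrix b M hdet : E ≃ₗ[ℂ] E) : E →ₗ[ℂ] E) := by
      refine b.ext fun c => ?_
      rw [LinearMap.comp_apply, LinearEquiv.coe_coe, dual_apply_eq b v.2]
      simp only [coord_slOfMatrix]
      rw [hrow c]
      simp [Finsupp.single_apply]
    exact LinearMap.congr_fun this e
  · simpa only [coord_slOfMatrix] using htri

theorem exists_coord_ne_zero (b : Module.Basis (Fin 3) ℂ E) {e : E} (he : e ≠ 0) :
    ∃ i, b.coord i e ≠ 0 := by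
  by_contra! h
  exact he (b.ext_elem (by simpa using h))

theorem exists_dual_basis_ne_zero (b : Module.Basis (Fin 3) ℂ E) {f : Module.Dual ℂ E}
    (hf : f ≠ 0) : ∃ i, f (b i) ≠ 0 := by
  by_contra! h
  exact hf (b.ext h)

/-- The indices `i`, `j` supplied by `exists_slAct_eq` depend on `v`. The reference pair has all
coordinates nonzero and pairing `1 + 1 - 2 = 0`, so it can be reached for every choice of `i ≠ j`.
-/
theorem exists_slAct_generic_eq (b : Module.Basis (Fin 3) ℂ E) {v : E × Module.Dual ℂ E}
    (h1 : v.1 ≠ 0) (h2 : v.2 ≠ 0) (hv : v.2 v.1 = 0) :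
    ∃ g : SpecialLinearGroup ℂ E, slAct g (b 0 + b 1 + b 2,
      b.coord 0 + b.coord 1 - (2 : ℂ) • b.coord 2) = v := by
  obtain ⟨i, hi⟩ := exists_coord_ne_zero b h1
  -- If `f` vanished on all basis vectors except the `i`-th, then `f e` would be a single nonzero
  -- product.
  obtain ⟨j, hij, hj⟩ : ∃ j, i ≠ j ∧ v.2 (b j) ≠ 0 := by
    by_contra! h
    obtain ⟨j, hj⟩ := exists_dual_basis_ne_zero b h2
    have hji : i = j := by
      by_contra hne
      exact hj (h j hne)
    subst hji
    rw [dual_apply_eq b] at hv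
    have := mul_ne_zero hj hi
    fin_cases i <;> simp_all
  obtain ⟨g, hg, -⟩ := exists_slAct_eq b hij hi hj hv
  obtain ⟨h, hh, -⟩ := exists_slAct_eq b hij
    (v := (b 0 + b 1 + b 2, b.coord 0 + b.coord 1 - (2 : ℂ) • b.coord 2))
    (by fin_cases i <;> simp) (by fin_cases j <;> simp) (by simp; norm_num)
  refine ⟨g * h⁻¹, ?_⟩
  rw [← hh, slAct_mul_inv, hg]

theorem orbitOf_top_eq_openOrbit (b : Module.Basis (Fin 3) ℂ E)
    {x : ℙ ℂ (E × Module.Dual ℂ E)} (hx : x ∈ openOrbit E) : orbitOf ⊤ x = openOrbit E := by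
  apply Set.Subset.antisymm
  · rintro _ ⟨g, -, rfl⟩
    exact (slProjAct_mem_openOrbit g x).mpr hx
  · intro y hy
    obtain ⟨g, hg⟩ := exists_slAct_generic_eq b hx.1 hx.2.1 hx.2.2
    obtain ⟨h, hh⟩ := exists_slAct_generic_eq b hy.1 hy.2.1 hy.2.2
    have := mk_mem_orbitOf x.rep_nonzero y.rep_nonzero (Subgroup.mem_top g) (Subgroup.mem_top h)
      hg hh
    rwa [Projectivization.mk_rep, Projectivization.mk_rep] at this

theorem isOpen_fst_snd_ne_zero (b : Module.Basis (Fin 3) ℂ E) :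
    IsOpen[projZariski (E × Module.Dual ℂ E)]
      {x : ℙ ℂ (E × Module.Dual ℂ E) | x.rep.1 ≠ 0 ∧ x.rep.2 ≠ 0} := by
  let := projZariski (E × Module.Dual ℂ E)
  have h1 : {x : ℙ ℂ (E × Module.Dual ℂ E) | x.rep.1 ≠ 0 ∧ x.rep.2 ≠ 0} =
      (⋃ i, {x : ℙ ℂ (E × Module.Dual ℂ E) |
        (b.coord i).comp (LinearMap.fst ℂ E (Module.Dual ℂ E)) x.rep ≠ 0}) ∩
      ⋃ i, {x : ℙ ℂ (E × Module.Dual ℂ E) |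
        (Module.Dual.eval ℂ E (b i)).comp (LinearMap.snd ℂ E (Module.Dual ℂ E)) x.rep ≠ 0} := by
    ext x
    simp only [Set.mem_inter_iff, Set.mem_iUnion]
    constructor
    · rintro ⟨h1, h2⟩
      exact ⟨exists_coord_ne_zero b h1, exists_dual_basis_ne_zero b h2⟩
    · rintro ⟨⟨i, hi⟩, ⟨j, hj⟩⟩
      refine ⟨fun h => hi ?_, fun h => hj ?_⟩
      · change b.coord i x.rep.1 = 0
        rw [h, map_zero]
      · change x.rep.2 (b j) = 0
        rw [h, LinearMap.zero_apply]
  rw [h1]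
  exact (isOpen_iUnion fun i => isOpen_linear_ne_zero _).inter
    (isOpen_iUnion fun i => isOpen_linear_ne_zero _)

/-- If `e` or `f` vanishes at a point of `O`, adding `t` times a nonzero vector of `ker f`, or a
nonzero form killing `e`, stays on the quadric and reaches `openOrbit` for `t ≠ 0`. The open set `U`
contains the limit at `t = 0`, hence also such points. -/
theorem mem_openOrbit_of_isOpenSLOrbit [FiniteDimensional ℂ E] (hE : 1 < Module.finrank ℂ E)
    {O : Set (ℙ ℂ (E × Module.Dual ℂ E))} (hO : IsOpenSLOrbit O) : ∃ y ∈ O, y ∈ openOrbit E := by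
  obtain ⟨⟨x, hxQ, hxO⟩, U, hU, hUO⟩ := hO
  obtain ⟨v, hv, rfl⟩ : ∃ v, ∃ hv : v ≠ 0, x = Projectivization.mk ℂ v hv :=
    ⟨x.rep, x.rep_nonzero, x.mk_rep.symm⟩
  rw [mk_mem_quadric] at hxQ
  let := projZariski (E × Module.Dual ℂ E)
  have hxU : Projectivization.mk ℂ v hv ∈ U := by
    have : Projectivization.mk ℂ v hv ∈ O := hxO ▸ mem_orbitOf_self _ _
    rw [hUO] at this
    exact this.1
  have line : ∀ q : E × Module.Dual ℂ E, (∀ t : ℂ, v + t • q ≠ 0) →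
      (∀ t : ℂ, t ≠ 0 → (v + t • q).1 ≠ 0 ∧ (v + t • q).2 ≠ 0 ∧ (v + t • q).2 (v + t • q).1 = 0) →
      ∃ y ∈ O, y ∈ openOrbit E := by
    intro q hne hq
    have hcl := mem_closure_of_line (S := openOrbit E) hne
      (fun t ht => (mk_mem_openOrbit (hne t)).mpr (hq t ht)) hv
    obtain ⟨y, hyU, hy⟩ := mem_closure_iff.mp hcl U hU hxU
    exact ⟨y, hUO ▸ ⟨hyU, hy.2.2⟩, hy⟩
  by_cases h1 : v.1 = 0
  · have h2 : v.2 ≠ 0 := fun h2 => hv (Prod.ext h1 h2)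
    obtain ⟨e, he, he0⟩ : ∃ e ∈ LinearMap.ker v.2, e ≠ 0 := by
      refine Submodule.exists_mem_ne_zero_of_ne_bot fun hbot => ?_
      have := Module.Dual.finrank_ker_add_one_of_ne_zero h2
      rw [hbot, finrank_bot] at this
      omega
    refine line (e, 0) (fun t h0 => h2 ?_) (fun t ht => ⟨?_, ?_, ?_⟩)
    · simpa using congrArg Prod.snd h0
    · simp [h1, ht, he0]
    · simpa using h2
    · have : v.2 e = 0 := he
      simp [h1, this]
  · by_cases h2 : v.2 = 0
    · obtain ⟨f, hf0, hf⟩ : ∃ f : Module.Dual ℂ E, f ≠ 0 ∧ f v.1 = 0 := by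
        have hlt : Submodule.span ℂ {v.1} < ⊤ := by
          refine lt_of_le_of_ne le_top fun h => ?_
          have := finrank_span_singleton (K := ℂ) h1
          rw [h, finrank_top] at this
          omega
        obtain ⟨f, hf0, hf⟩ := Submodule.exists_le_ker_of_lt_top _ hlt
        exact ⟨f, hf0, hf (Submodule.mem_span_singleton_self _)⟩
      refine line (0, f) (fun t h0 => h1 ?_) (fun t ht => ⟨?_, ?_, ?_⟩)
      · simpa using congrArg Prod.fst h0
      · simpa using h1
      · simp [h2, ht, hf0]
      · simp [h2, hf]
    · exact ⟨_, hxO ▸ mem_orbitOf_self _ _, (mk_mem_openOrbit hv).mpr ⟨h1, h2, hxQ⟩⟩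

theorem isOpenSLOrbit_iff (hE : Module.finrank ℂ E = 3) {O : Set (ℙ ℂ (E × Module.Dual ℂ E))} :
    IsOpenSLOrbit O ↔ O = openOrbit E := by
  have : FiniteDimensional ℂ E := FiniteDimensional.of_finrank_pos (by omega)
  let b : Module.Basis (Fin 3) ℂ E := Module.finBasisOfFinrankEq ℂ E hE
  constructor
  · intro hO
    obtain ⟨y, hyO, hy⟩ := mem_openOrbit_of_isOpenSLOrbit (by omega) hO
    obtain ⟨⟨x, -, rfl⟩, -⟩ := hO
    obtain ⟨g, -, rfl⟩ := hyO
    exact orbitOf_top_eq_openOrbit b ((slProjAct_mem_openOrbit g x).mp hy)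
  · rintro rfl
    have hne : ((b 0, b.coord 1) : E × Module.Dual ℂ E) ≠ 0 :=
      fun h => b.ne_zero 0 (congrArg Prod.fst h)
    refine ⟨⟨Projectivization.mk ℂ (b 0, b.coord 1) hne, ?_, ?_⟩, _, isOpen_fst_snd_ne_zero b, ?_⟩
    · rw [mk_mem_quadric]
      simp
    · refine (orbitOf_top_eq_openOrbit b ((mk_mem_openOrbit hne).mpr ⟨b.ne_zero 0, ?_, ?_⟩)).symm
      · intro h
        simpa using LinearMap.congr_fun h (b 1)
      · simp
    · ext x
      exact and_assoc.symm

end Action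

/-! ### Borel orbits as cells, and their closures -/

section Cells

variable {E : Type*} [AddCommGroup E] [Module ℂ E]

/-- The cone over the closure of the cell of pairs `(e, f)`, `f e = 0`, for which `i` is the last
nonzero coordinate of `e` and `j` is the first nonzero coordinate of `f`. -/
def IsInCellClosure (b : Module.Basis (Fin 3) ℂ E) (i j : Fin 3) (v : E × Module.Dual ℂ E) :
    Prop :=
  (∀ k, i < k → b.coord k v.1 = 0) ∧ (∀ k, k < j → v.2 (b k) = 0) ∧ v.2 v.1 = 0

/-- The projectivization of the cone `IsInCellClosure b i j`. -/
def cellClosure (b : Module.Basis (Fin 3) ℂ E) (i j : Fin 3) :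
    Set (ℙ ℂ (E × Module.Dual ℂ E)) :=
  {x | IsInCellClosure b i j x.rep}

theorem mk_mem_cellClosure {b : Module.Basis (Fin 3) ℂ E} {i j : Fin 3}
    {v : E × Module.Dual ℂ E} (hv : v ≠ 0) :
    Projectivization.mk ℂ v hv ∈ cellClosure b i j ↔ IsInCellClosure b i j v := by
  obtain ⟨a, ha⟩ := Projectivization.exists_smul_eq_mk_rep ℂ v hv
  change IsInCellClosure b i j (Projectivization.mk ℂ v hv).rep ↔ _
  rw [← ha]
  simp [Units.smul_def, IsInCellClosure]

theorem isClosed_quadric (b : Module.Basis (Fin 3) ℂ E) :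
    IsClosed[projZariski (E × Module.Dual ℂ E)] (quadric E) := by
  let ev : Fin 3 → Module.Dual ℂ (E × Module.Dual ℂ E) := fun i =>
    (Module.Dual.eval ℂ E (b i)).comp (LinearMap.snd ℂ E (Module.Dual ℂ E))
  let co : Fin 3 → Module.Dual ℂ (E × Module.Dual ℂ E) := fun i =>
    (b.coord i).comp (LinearMap.fst ℂ E (Module.Dual ℂ E))
  have hP : (∑ i, MvPolynomial.X (R := ℂ) (ev i) * MvPolynomial.X (co i)).IsHomogeneous 2 :=
    MvPolynomial.IsHomogeneous.sum _ _ _ fun i _ =>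
      (MvPolynomial.isHomogeneous_X ℂ _).mul (MvPolynomial.isHomogeneous_X ℂ _)
  convert isClosed_vanishing hP using 1
  ext x
  change x.rep.2 x.rep.1 = 0 ↔ _
  rw [dual_apply_eq b]
  simp [polyEval, ev, co, Fin.sum_univ_three]

theorem isClosed_cellClosure (b : Module.Basis (Fin 3) ℂ E) (i j : Fin 3) :
    IsClosed[projZariski (E × Module.Dual ℂ E)] (cellClosure b i j) := by
  let := projZariski (E × Module.Dual ℂ E)
  have : cellClosure b i j =
      (⋂ k, ⋂ (_ : i < k), {x : ℙ ℂ (E × Module.Dual ℂ E) |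
        (b.coord k).comp (LinearMap.fst ℂ E (Module.Dual ℂ E)) x.rep = 0}) ∩
      ((⋂ k, ⋂ (_ : k < j), {x : ℙ ℂ (E × Module.Dual ℂ E) |
        (Module.Dual.eval ℂ E (b k)).comp (LinearMap.snd ℂ E (Module.Dual ℂ E)) x.rep = 0}) ∩
        quadric E) := by
    ext x
    simp only [Set.mem_inter_iff, Set.mem_iInter]
    rfl
  rw [this]
  exact (isClosed_iInter fun k => isClosed_iInter fun _ => isClosed_linear_eq_zero _).inter
    ((isClosed_iInter fun k => isClosed_iInter fun _ => isClosed_linear_eq_zero _).inter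
      (isClosed_quadric b))

theorem IsAdapted.mem_flagSpace {b : Module.Basis (Fin 3) ℂ E} {F₁ F₂ : Submodule ℂ E}
    (h : IsAdapted b F₁ F₂) (n : ℕ) (v : E) :
    v ∈ flagSpace F₁ F₂ n ↔ ∀ k : Fin 3, n ≤ k → b.coord k v = 0 := by
  match n with
  | 0 =>
    constructor
    · intro hv k _
      have : v = 0 := hv
      rw [this, map_zero]
    · intro hv
      exact b.ext_elem fun i => by simpa using hv i (Nat.zero_le _)
  | 1 =>
    refine (h.1 v).trans ?_
    simp [Fin.forall_fin_succ]
  | 2 =>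
    refine (h.2 v).trans ?_
    simp [Fin.forall_fin_succ]
  | n + 3 =>
    exact ⟨fun _ k hk => absurd k.2 (by omega), fun _ => Submodule.mem_top⟩

/-- A degenerate point of the cone is a limit, along a line inside the cone, of points with more of
the two leading coordinates nonzero. When both vanish, one passes through points where at least one
is nonzero and takes a closure twice. -/
theorem mem_closure_cell {b : Module.Basis (Fin 3) ℂ E} {i j : Fin 3} (hij : i ≠ j)
    {S : Set (ℙ ℂ (E × Module.Dual ℂ E))}
    (hS : ∀ (v : E × Module.Dual ℂ E) (hv : v ≠ 0), IsInCellClosure b i j v →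
      b.coord i v.1 ≠ 0 → v.2 (b j) ≠ 0 → Projectivization.mk ℂ v hv ∈ S)
    {v : E × Module.Dual ℂ E} (hv0 : v ≠ 0) (hv : IsInCellClosure b i j v) :
    Projectivization.mk ℂ v hv0 ∈ closure[projZariski (E × Module.Dual ℂ E)] S := by
  let := projZariski (E × Module.Dual ℂ E)
  have step1 : ∀ (v : E × Module.Dual ℂ E) (hv0 : v ≠ 0), IsInCellClosure b i j v →
      b.coord i v.1 ≠ 0 → Projectivization.mk ℂ v hv0 ∈ closure S := by
    rintro ⟨e, f⟩ hv0 ⟨h1, h2, h3⟩ hi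
    simp only at h1 h2 h3 hi
    by_cases hj : f (b j) = 0
    · refine mem_closure_of_line
        (q := (0, b.coord i e • b.coord j - b.coord j e • b.coord i)) (fun t h0 => hi ?_)
        (fun t ht => hS _ _ ⟨fun k hk => ?_, fun k hk => ?_, ?_⟩ ?_ ?_) hv0
      · have : e = 0 := by simpa using congrArg Prod.fst h0
        rw [this, map_zero]
      · simpa using h1 k hk
      · have hkj : k ≠ j := hk.ne
        have h4 : k = i → b.coord j e = 0 := by
          rintro rfl
          exact h1 j hk
        by_cases hki : k = i
        · have := h4 hki
          subst hki
          simp only [Module.Basis.coord_apply] at this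
          simp [h2 k hk, this, hkj]
        · simp [h2 k hk, hkj, hki]
      · simp [h3]
        right
        ring
      · simpa using hi
      · simp only [Module.Basis.coord_apply] at hi
        simp [hj, hij.symm, ht, hi]
    · exact subset_closure (hS _ _ ⟨h1, h2, h3⟩ hi hj)
  have step2 : ∀ (v : E × Module.Dual ℂ E) (hv0 : v ≠ 0), IsInCellClosure b i j v →
      v.2 (b j) ≠ 0 → Projectivization.mk ℂ v hv0 ∈ closure S := by
    rintro ⟨e, f⟩ hv0 ⟨h1, h2, h3⟩ hj
    simp only at h1 h2 h3 hj
    by_cases hi : b.coord i e = 0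
    · refine mem_closure_of_line
        (q := (f (b j) • b i - f (b i) • b j, 0)) (fun t h0 => hj ?_)
        (fun t ht => hS _ _ ⟨fun k hk => ?_, fun k hk => ?_, ?_⟩ ?_ ?_) hv0
      · have : f = 0 := by simpa using congrArg Prod.snd h0
        rw [this, LinearMap.zero_apply]
      · have hki : i ≠ k := hk.ne
        have h4 := h1 k hk
        simp only [Module.Basis.coord_apply] at h4
        by_cases hkj : j = k
        · subst hkj
          simp [h4, h2 i hk, hki]
        · simp [h4, hkj, hki]
      · simpa using h2 k hk
      · simp [h3]
        right
        ring
      · simp only [Module.Basis.coord_apply] at hi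
        simp [hi, hij.symm, ht, hj]
      · simpa using hj
    · exact subset_closure (hS _ _ ⟨h1, h2, h3⟩ hi hj)
  by_cases hi : b.coord i v.1 = 0
  · by_cases hj : v.2 (b j) = 0
    · obtain ⟨e, f⟩ := v
      obtain ⟨h1, h2, h3⟩ := hv
      simp only at h1 h2 h3 hi hj
      -- Moving `e` along `α • b i` and `f` along `β • b.coord j` changes the pairing by `t` times
      -- this expression; there is no `t²` term because `i ≠ j`. A nonzero solution makes at least
      -- one leading coordinate nonzero.
      obtain ⟨α, β, hαβ, hne⟩ : ∃ α β : ℂ, α * f (b i) + β * b.coord j e = 0 ∧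
          (α ≠ 0 ∨ β ≠ 0) := by
        by_cases hz : f (b i) = 0
        · exact ⟨1, 0, by simp [hz], Or.inl one_ne_zero⟩
        · exact ⟨b.coord j e, -f (b i), by ring, Or.inr (neg_ne_zero.mpr hz)⟩
      rw [← closure_closure]
      have c1 : ∀ t : ℂ, b.coord i (e + t • α • b i) = t * α := by
        intro t
        simp only [Module.Basis.coord_apply] at hi
        simp [hi]
      have c2 : ∀ t : ℂ, (f + t • β • b.coord j) (b j) = t * β := by
        intro t
        simp [hj]
      have hcond : ∀ t : ℂ, IsInCellClosure b i j (e + t • α • b i, f + t • β • b.coord j) := by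
        intro t
        refine ⟨fun k hk => ?_, fun k hk => ?_, ?_⟩
        · have h4 := h1 k hk
          simp only [Module.Basis.coord_apply] at h4
          simp [h4, hk.ne]
        · simp [h2 k hk, hk.ne]
        · simp only [Module.Basis.coord_apply] at hαβ
          simp [h3, hij]
          linear_combination t * hαβ
      refine mem_closure_of_line (q := (α • b i, β • b.coord j)) (fun t h0 => ?_)
        (fun t ht => ?_) hv0
      · have ha := congrArg (fun v : E × Module.Dual ℂ E => b.coord i v.1) h0
        have hb := congrArg (fun v : E × Module.Dual ℂ E => v.2 (b j)) h0
        have ha' : t * α = 0 := by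
          rw [← c1 t]
          simpa using ha
        have hb' : t * β = 0 := by
          rw [← c2 t]
          simpa using hb
        have ht : t = 0 := by
          rcases hne with hne | hne
          · exact (mul_eq_zero.mp ha').resolve_right hne
          · exact (mul_eq_zero.mp hb').resolve_right hne
        rw [ht, zero_smul, add_zero] at h0
        exact hv0 h0
      · rcases hne with hne | hne
        · refine step1 _ _ (hcond t) ?_
          change b.coord i (e + t • α • b i) ≠ 0
          rw [c1]
          exact mul_ne_zero ht hne
        · refine step2 _ _ (hcond t) ?_
          change (f + t • β • b.coord j) (b j) ≠ 0
          rw [c2]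
          exact mul_ne_zero ht hne
    · exact step2 v hv0 hv hj
  · exact step1 v hv0 hv hi

/-- Take `i` to be the last nonzero coordinate of `e` and `j` the first of `f`. If they agreed, all
other products in `f e` would vanish and leave one nonzero term. -/
theorem exists_cell (b : Module.Basis (Fin 3) ℂ E) {v : E × Module.Dual ℂ E} (h1 : v.1 ≠ 0)
    (h2 : v.2 ≠ 0) (hv : v.2 v.1 = 0) : ∃ i j : Fin 3, i ≠ j ∧ IsInCellClosure b i j v ∧
      b.coord i v.1 ≠ 0 ∧ v.2 (b j) ≠ 0 := by
  obtain ⟨i, hi, hi'⟩ : ∃ i, b.coord i v.1 ≠ 0 ∧ ∀ k, i < k → b.coord k v.1 = 0 := by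
    obtain ⟨i, hi⟩ := Set.Finite.exists_maximal (Set.toFinite {i | b.coord i v.1 ≠ 0})
      (exists_coord_ne_zero b h1)
    exact ⟨i, hi.prop, fun k hk => by_contra fun hne => hi.not_prop_of_gt hk hne⟩
  obtain ⟨j, hj, hj'⟩ : ∃ j, v.2 (b j) ≠ 0 ∧ ∀ k, k < j → v.2 (b k) = 0 := by
    obtain ⟨j, hj⟩ := Set.Finite.exists_minimal (Set.toFinite {j | v.2 (b j) ≠ 0})
      (exists_dual_basis_ne_zero b h2)
    exact ⟨j, hj.prop, fun k hk => by_contra fun hne => hj.not_prop_of_lt hk hne⟩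
  refine ⟨i, j, ?_, ⟨hi', hj', hv⟩, hi, hj⟩
  rintro rfl
  have hprod : ∀ l, l ≠ i → v.2 (b l) * b.coord l v.1 = 0 := by
    intro l hl
    rcases lt_or_gt_of_ne hl with hl | hl
    · rw [hj' l hl, zero_mul]
    · rw [hi' l hl, mul_zero]
  have hne := mul_ne_zero hj hi
  rw [dual_apply_eq b] at hv
  fin_cases i
  · rw [hprod 1 (by decide), hprod 2 (by decide), add_zero, add_zero] at hv
    exact hne hv
  · rw [hprod 0 (by decide), hprod 2 (by decide), zero_add, add_zero] at hv
    exact hne hv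
  · rw [hprod 0 (by decide), hprod 1 (by decide), zero_add, zero_add] at hv
    exact hne hv

variable [FiniteDimensional ℂ E]

/-- The condition on `e` is membership in the flag space of dimension `i + 1`, indices starting at
0. The condition on `f` is vanishing on the flag space of dimension `j`, which `g⁻¹` preserves. -/
theorem IsAdapted.slAct_isInCellClosure {b : Module.Basis (Fin 3) ℂ E} {F₁ F₂ : Submodule ℂ E}
    (h : IsAdapted b F₁ F₂) {i j : Fin 3} {v : E × Module.Dual ℂ E}
    (hv : IsInCellClosure b i j v) {g : SpecialLinearGroup ℂ E} (hg : g ∈ flagStabilizer h.le) :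
    IsInCellClosure b i j (slAct g v) := by
  refine ⟨?_, ?_, by rw [slAct_pairing, hv.2.2]⟩
  · intro k hk
    have hm : v.1 ∈ flagSpace F₁ F₂ (i + 1) :=
      (h.mem_flagSpace _ _).mpr fun k hk => hv.1 k (Fin.lt_def.mpr hk)
    exact (h.mem_flagSpace _ _).mp (apply_mem_of_mem_filtrationSubgroup hg hm) k hk
  · intro k hk
    have hm : b k ∈ flagSpace F₁ F₂ j := (h.mem_flagSpace _ _).mpr fun l hl => by
      have : k ≠ l := by
        rintro rfl
        exact absurd hk (not_lt.mpr hl)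
      simp [this]
    have hm' := (h.mem_flagSpace _ _).mp
      (apply_mem_of_mem_filtrationSubgroup (Subgroup.inv_mem _ hg) hm)
    rw [slAct_snd_apply]
    change v.2 (((g⁻¹ : SpecialLinearGroup ℂ E) : E ≃ₗ[ℂ] E) (b k)) = 0
    have hprod : ∀ l, v.2 (b l) *
        b.coord l (((g⁻¹ : SpecialLinearGroup ℂ E) : E ≃ₗ[ℂ] E) (b k)) = 0 := by
      intro l
      rcases lt_or_ge l j with hl | hl
      · rw [hv.2.1 l hl, zero_mul]
      · rw [hm' l hl, mul_zero]
    rw [dual_apply_eq b, hprod, hprod, hprod, add_zero, add_zero]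

/-- The cells are orbits of the stabilizer of the flag. -/
theorem IsAdapted.cell_subset_orbitOf {b : Module.Basis (Fin 3) ℂ E} {F₁ F₂ : Submodule ℂ E}
    (h : IsAdapted b F₁ F₂) {i j : Fin 3} (hij : i ≠ j) {v w : E × Module.Dual ℂ E}
    (hv0 : v ≠ 0) (hw0 : w ≠ 0) (hv : IsInCellClosure b i j v) (hvi : b.coord i v.1 ≠ 0)
    (hvj : v.2 (b j) ≠ 0) (hw : IsInCellClosure b i j w) (hwi : b.coord i w.1 ≠ 0)
    (hwj : w.2 (b j) ≠ 0) :
    Projectivization.mk ℂ w hw0 ∈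
      orbitOf (flagStabilizer h.le) (Projectivization.mk ℂ v hv0) := by
  obtain ⟨g, hg, hg'⟩ := exists_slAct_eq b hij hvi hvj hv.2.2
  obtain ⟨g', hg₂, hg₂'⟩ := exists_slAct_eq b hij hwi hwj hw.2.2
  exact mk_mem_orbitOf hv0 hw0 (h.mem_flagStabilizer_iff.mpr (hg' hv.1 hv.2.1))
    (h.mem_flagStabilizer_iff.mpr (hg₂' hw.1 hw.2.1)) hg hg₂

theorem IsAdapted.closure_orbitOf {b : Module.Basis (Fin 3) ℂ E} {F₁ F₂ : Submodule ℂ E}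
    (h : IsAdapted b F₁ F₂) {i j : Fin 3} (hij : i ≠ j) {v : E × Module.Dual ℂ E}
    (hv0 : v ≠ 0) (hv : IsInCellClosure b i j v) (hvi : b.coord i v.1 ≠ 0)
    (hvj : v.2 (b j) ≠ 0) :
    closure[projZariski (E × Module.Dual ℂ E)]
      (orbitOf (flagStabilizer h.le) (Projectivization.mk ℂ v hv0)) = cellClosure b i j := by
  let := projZariski (E × Module.Dual ℂ E)
  apply Set.Subset.antisymm
  · refine closure_minimal ?_ (isClosed_cellClosure b i j)
    rintro _ ⟨g, hg, rfl⟩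
    rw [slProjAct_mk, mk_mem_cellClosure]
    exact h.slAct_isInCellClosure hv hg
  · intro x hx
    have := mem_closure_cell hij (S := orbitOf (flagStabilizer h.le) (Projectivization.mk ℂ v hv0))
      (fun w hw0 hw hwi hwj => h.cell_subset_orbitOf hij hv0 hw0 hv hvi hvj hw hwi hwj)
      x.rep_nonzero hx
    rwa [Projectivization.mk_rep] at this

end Cells

/-! ### Identification of the six closures and the classification -/

section OrbitClosures

variable {E : Type*} [AddCommGroup E] [Module ℂ E]

theorem cellClosure_eq_projSubspace {b : Module.Basis (Fin 3) ℂ E} {i j : Fin 3}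
    {W : Submodule ℂ (E × Module.Dual ℂ E)} (h : ∀ v, IsInCellClosure b i j v ↔ v ∈ W) :
    cellClosure b i j = projSubspace W := by
  ext x
  refine (h x.rep).trans ?_
  rw [← mk_mem_projSubspace x.rep_nonzero, Projectivization.mk_rep]

theorem cellClosure_two_zero (b : Module.Basis (Fin 3) ℂ E) : cellClosure b 2 0 = quadric E := by
  ext x
  refine ⟨fun h => h.2.2, fun h => ⟨fun k hk => ?_, fun k hk => ?_, h⟩⟩
  · exact absurd hk (by omega)
  · exact absurd hk (by omega)

theorem IsAdapted.mem_dualAnnihilator_fst {b : Module.Basis (Fin 3) ℂ E} {F₁ F₂ : Submodule ℂ E}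
    (h : IsAdapted b F₁ F₂) (f : Module.Dual ℂ E) :
    f ∈ F₁.dualAnnihilator ↔ f (b 0) = 0 := by
  rw [Submodule.mem_dualAnnihilator]
  constructor
  · exact fun hf => hf _ ((h.1 _).mpr (by simp))
  · intro hf e he
    obtain ⟨h1, h2⟩ := (h.1 e).mp he
    rw [dual_apply_eq b, hf, h1, h2]
    simp

theorem IsAdapted.mem_dualAnnihilator_snd {b : Module.Basis (Fin 3) ℂ E} {F₁ F₂ : Submodule ℂ E}
    (h : IsAdapted b F₁ F₂) (f : Module.Dual ℂ E) :
    f ∈ F₂.dualAnnihilator ↔ f (b 0) = 0 ∧ f (b 1) = 0 := by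
  rw [Submodule.mem_dualAnnihilator]
  constructor
  · exact fun hf => ⟨hf _ ((h.2 _).mpr (by simp)), hf _ ((h.2 _).mpr (by simp))⟩
  · rintro ⟨h1, h2⟩ e he
    rw [dual_apply_eq b, h1, h2, (h.2 e).mp he]
    simp

theorem IsAdapted.cellClosure_zero_one {b : Module.Basis (Fin 3) ℂ E} {F₁ F₂ : Submodule ℂ E}
    (h : IsAdapted b F₁ F₂) :
    cellClosure b 0 1 = projSubspace (F₁.prod F₁.dualAnnihilator) := by
  refine cellClosure_eq_projSubspace fun v => ?_
  rw [Submodule.mem_prod, h.mem_dualAnnihilator_fst, h.1]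
  constructor
  · exact fun hv => ⟨⟨hv.1 1 (by decide), hv.1 2 (by decide)⟩, hv.2.1 0 (by decide)⟩
  · rintro ⟨⟨h1, h2⟩, h3⟩
    refine ⟨fun k hk => ?_, fun k hk => ?_, ?_⟩
    · fin_cases k
      · exact absurd hk (by decide)
      · exact h1
      · exact h2
    · fin_cases k
      · exact h3
      · exact absurd hk (by decide)
      · exact absurd hk (by decide)
    · rw [dual_apply_eq b, h1, h2, h3]
      simp

theorem IsAdapted.cellClosure_zero_two {b : Module.Basis (Fin 3) ℂ E} {F₁ F₂ : Submodule ℂ E}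
    (h : IsAdapted b F₁ F₂) :
    cellClosure b 0 2 = projSubspace (F₁.prod F₂.dualAnnihilator) := by
  refine cellClosure_eq_projSubspace fun v => ?_
  rw [Submodule.mem_prod, h.mem_dualAnnihilator_snd, h.1]
  constructor
  · exact fun hv => ⟨⟨hv.1 1 (by decide), hv.1 2 (by decide)⟩, hv.2.1 0 (by decide),
      hv.2.1 1 (by decide)⟩
  · rintro ⟨⟨h1, h2⟩, h3, h4⟩
    refine ⟨fun k hk => ?_, fun k hk => ?_, ?_⟩
    · fin_cases k
      · exact absurd hk (by decide)
      · exact h1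
      · exact h2
    · fin_cases k
      · exact h3
      · exact h4
      · exact absurd hk (by decide)
    · rw [dual_apply_eq b, h1, h2, h3]
      simp

theorem IsAdapted.cellClosure_one_two {b : Module.Basis (Fin 3) ℂ E} {F₁ F₂ : Submodule ℂ E}
    (h : IsAdapted b F₁ F₂) :
    cellClosure b 1 2 = projSubspace (F₂.prod F₂.dualAnnihilator) := by
  refine cellClosure_eq_projSubspace fun v => ?_
  rw [Submodule.mem_prod, h.mem_dualAnnihilator_snd, h.2]
  constructor
  · exact fun hv => ⟨hv.1 2 (by decide), hv.2.1 0 (by decide), hv.2.1 1 (by decide)⟩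
  · rintro ⟨h2, h3, h4⟩
    refine ⟨fun k hk => ?_, fun k hk => ?_, ?_⟩
    · fin_cases k
      · exact absurd hk (by decide)
      · exact absurd hk (by decide)
      · exact h2
    · fin_cases k
      · exact h3
      · exact h4
      · exact absurd hk (by decide)
    · rw [dual_apply_eq b, h2, h3, h4]
      simp

/-- Here `w` lies over the vertex of the cone. The lines from it towards `b m` and `b.coord m` lie
in the cone, but the quadratic form takes the value 1 on the sum of the two directions. -/
theorem not_isSmoothVariety_cellClosure {b : Module.Basis (Fin 3) ℂ E} {i j m n : Fin 3}
    (hmn : m ≠ n) {w : E × Module.Dual ℂ E} (hw : w ≠ 0)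
    (h₁ : ∀ s t : ℂ, IsInCellClosure b i j (s • w + t • (b m, 0)))
    (h₂ : ∀ s t : ℂ, IsInCellClosure b i j (s • w + t • (0, b.coord m)))
    (hwm : b.coord m w.1 = 0) (hwn : b.coord n w.1 = 0) (hwm' : w.2 (b m) = 0)
    (hwn' : w.2 (b n) = 0)
    (hrel : ∀ v : E × Module.Dual ℂ E, IsInCellClosure b i j v →
      b.coord m v.1 * v.2 (b m) + b.coord n v.1 * v.2 (b n) = 0) :
    ¬ IsSmoothVariety (cellClosure b i j) := by
  intro hsm
  obtain ⟨φ, hφ, hsmooth⟩ := hsm (Projectivization.mk ℂ w hw)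
    ((mk_mem_cellClosure hw).mpr (by simpa using h₁ 1 0))
  have hφw : φ w ≠ 0 := by
    obtain ⟨a, ha⟩ := Projectivization.exists_smul_eq_mk_rep ℂ w hw
    rw [← ha, Units.smul_def, map_smul] at hφ
    exact right_ne_zero_of_mul hφ
  have hchart : ∀ v, φ v = 1 → IsInCellClosure b i j v → v ∈ affineChart (cellClosure b i j) φ := by
    intro v hv hc
    have hv0 : v ≠ 0 := by
      rintro rfl
      rw [map_zero] at hv
      exact zero_ne_one hv
    exact ⟨hv, hv0, (mk_mem_cellClosure hv0).mpr hc⟩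
  obtain ⟨w', hw'⟩ : ∃ w', w' = (φ w)⁻¹ • w := ⟨_, rfl⟩
  have hφw' : φ w' = 1 := by simp [hw', hφw]
  let ev : Fin 3 → Module.Dual ℂ (E × Module.Dual ℂ E) := fun i =>
    (Module.Dual.eval ℂ E (b i)).comp (LinearMap.snd ℂ E (Module.Dual ℂ E))
  let co : Fin 3 → Module.Dual ℂ (E × Module.Dual ℂ E) := fun i =>
    (b.coord i).comp (LinearMap.fst ℂ E (Module.Dual ℂ E))
  have hco : ∀ k, b.coord k w.1 = 0 → co k w' = 0 := by
    intro k hk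
    rw [hw']
    change b.coord k ((φ w)⁻¹ • w.1) = 0
    rw [map_smul, hk, smul_zero]
  have hev : ∀ k, w.2 (b k) = 0 → ev k w' = 0 := by
    intro k hk
    rw [hw']
    change (φ w)⁻¹ • w.2 (b k) = 0
    rw [hk, smul_zero]
  -- Subtracting `φ u • w'` keeps the line in the hyperplane `φ = 1`; the quadratic form is
  -- unaffected, since its four linear forms vanish at `w'`.
  have hline : ∀ u, (∀ s t : ℂ, IsInCellClosure b i j (s • w + t • u)) →
      ∀ t : ℂ, w' + t • (u - φ u • w') ∈ affineChart (cellClosure b i j) φ := by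
    intro u hu t
    refine hchart _ ?_ ?_
    · rw [map_add, map_smul, map_sub, map_smul, hφw']
      simp
    · have := hu ((1 - t * φ u) * (φ w)⁻¹) t
      convert this using 1
      rw [hw']
      module
  refine not_smooth_coordinateRing (hline (b m, 0) h₁) (hline (0, b.coord m) h₂) (co m) (ev m)
    (co n) (ev n) (hco m hwm) (hev m hwm') (hco n hwn) (hev n hwn') ?_ ?_ hsmooth
  · rintro z ⟨-, hz0, hz⟩
    exact hrel z ((mk_mem_cellClosure hz0).mp hz)
  · have e1 : co m ((b m, 0) - φ (b m, 0) • w' +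
        ((0, b.coord m) - φ (0, b.coord m) • w')) = 1 := by
      rw [map_add, map_sub, map_sub, map_smul, map_smul, hco m hwm]
      simp [co]
    have e2 : co n ((b m, 0) - φ (b m, 0) • w' +
        ((0, b.coord m) - φ (0, b.coord m) • w')) = 0 := by
      rw [map_add, map_sub, map_sub, map_smul, map_smul, hco n hwn]
      simp [co, hmn]
    have e3 : ev m ((b m, 0) - φ (b m, 0) • w' +
        ((0, b.coord m) - φ (0, b.coord m) • w')) = 1 := by
      rw [map_add, map_sub, map_sub, map_smul, map_smul, hev m hwm']
      simp [ev]
    rw [e1, e2, e3]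
    simp

/-- The equations are `e₂ = 0` and `e₀f₀ + e₁f₁ = 0`. The coordinate `f₂` is free, so the vertex is
the class of `b.coord 2`. -/
theorem not_isSmoothVariety_cellClosure_one_zero (b : Module.Basis (Fin 3) ℂ E) :
    ¬ IsSmoothVariety (cellClosure b 1 0) := by
  have hcond : ∀ v : E × Module.Dual ℂ E, b.coord 2 v.1 = 0 → v.2 v.1 = 0 →
      IsInCellClosure b 1 0 v := by
    intro v h1 h2
    refine ⟨fun k hk => ?_, fun k hk => absurd hk (by omega), h2⟩
    obtain rfl : k = 2 := by omega
    exact h1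
  refine not_isSmoothVariety_cellClosure (m := 0) (n := 1) (w := (0, b.coord 2)) (by decide)
    (fun h => ?_) (fun s t => hcond _ ?_ ?_) (fun s t => hcond _ ?_ ?_) ?_ ?_ ?_ ?_
    (fun v hv => ?_)
  · simpa using LinearMap.congr_fun (congrArg Prod.snd h) (b 2)
  any_goals simp
  · have h1 := hv.2.2
    rw [dual_apply_eq b, hv.1 2 (by decide)] at h1
    simp only [Module.Basis.coord_apply] at h1
    linear_combination h1

/-- The equations are `f₀ = 0` and `e₁f₁ + e₂f₂ = 0`. The coordinate `e₀` is free, so the vertex is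
the class of `b 0`. -/
theorem not_isSmoothVariety_cellClosure_two_one (b : Module.Basis (Fin 3) ℂ E) :
    ¬ IsSmoothVariety (cellClosure b 2 1) := by
  have hcond : ∀ v : E × Module.Dual ℂ E, v.2 (b 0) = 0 → v.2 v.1 = 0 →
      IsInCellClosure b 2 1 v := by
    intro v h1 h2
    refine ⟨fun k hk => absurd hk (by omega), fun k hk => ?_, h2⟩
    obtain rfl : k = 0 := by omega
    exact h1
  refine not_isSmoothVariety_cellClosure (m := 1) (n := 2) (w := (b 0, 0)) (by decide)
    (fun h => ?_) (fun s t => hcond _ ?_ ?_) (fun s t => hcond _ ?_ ?_) ?_ ?_ ?_ ?_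
    (fun v hv => ?_)
  · exact b.ne_zero 0 (congrArg Prod.fst h)
  any_goals simp
  · have h1 := hv.2.2
    rw [dual_apply_eq b, hv.2.1 0 (by decide)] at h1
    simp only [Module.Basis.coord_apply] at h1
    linear_combination h1

theorem IsFlag.smoothOrbitClosures_eq (hE : Module.finrank ℂ E = 3) [FiniteDimensional ℂ E]
    {F₁ F₂ : Submodule ℂ E} (hF : IsFlag F₁ F₂) :
    smoothOrbitClosures (flagStabilizer hF.2.2) (openOrbit E) =
      {quadric E, projSubspace (F₁.prod F₁.dualAnnihilator),
        projSubspace (F₂.prod F₂.dualAnnihilator),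
        projSubspace (F₁.prod F₂.dualAnnihilator)} := by
  obtain ⟨b, hb⟩ := hF.exists_adapted hE
  have hmem : ∀ i j : Fin 3, i ≠ j → IsSmoothVariety (cellClosure b i j) →
      cellClosure b i j ∈ smoothOrbitClosures (flagStabilizer hF.2.2) (openOrbit E) := by
    intro i j hij hsm
    have hne : ((b i, b.coord j) : E × Module.Dual ℂ E) ≠ 0 :=
      fun h => b.ne_zero i (congrArg Prod.fst h)
    have hpair : b.coord j (b i) = 0 := by simp [hij]
    have hbj : b.coord j (b j) ≠ 0 := by simp
    have hbi : b.coord i (b i) ≠ 0 := by simp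
    have hcell : IsInCellClosure b i j (b i, b.coord j) := by
      refine ⟨fun k hk => ?_, fun k hk => ?_, hpair⟩
      · simp [hk.ne]
      · simp [hk.ne]
    refine ⟨Projectivization.mk ℂ _ hne, (mk_mem_quadric hne).mpr hpair,
      ⟨_, mem_orbitOf_self _ _, (mk_mem_openOrbit hne).mpr ⟨b.ne_zero i, ?_, hpair⟩⟩,
      (hb.closure_orbitOf hij hne hcell hbi hbj).symm, hsm⟩
    intro h0
    exact hbj (LinearMap.congr_fun h0 (b j))
  have hproj : ∀ i j : Fin 3, i ≠ j → ∀ W, cellClosure b i j = projSubspace W →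
      projSubspace W ∈ smoothOrbitClosures (flagStabilizer hF.2.2) (openOrbit E) := by
    intro i j hij W hW
    rw [← hW]
    refine hmem i j hij ?_
    rw [hW]
    exact isSmoothVariety_projSubspace W
  ext X
  simp only [Set.mem_insert_iff, Set.mem_singleton_iff]
  constructor
  · rintro ⟨x, -, ⟨_, ⟨g, -, rfl⟩, hxO⟩, rfl, hsm⟩
    rw [slProjAct_mem_openOrbit] at hxO
    obtain ⟨i, j, hij, hcell, hi, hj⟩ := exists_cell b hxO.1 hxO.2.1 hxO.2.2
    have hcl := hb.closure_orbitOf hij x.rep_nonzero hcell hi hj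
    rw [Projectivization.mk_rep] at hcl
    rw [hcl] at hsm ⊢
    fin_cases i <;> fin_cases j
    · exact absurd rfl hij
    · exact Or.inr (Or.inl hb.cellClosure_zero_one)
    · exact Or.inr (Or.inr (Or.inr hb.cellClosure_zero_two))
    · exact absurd hsm (not_isSmoothVariety_cellClosure_one_zero b)
    · exact absurd rfl hij
    · exact Or.inr (Or.inr (Or.inl hb.cellClosure_one_two))
    · exact Or.inl (cellClosure_two_zero b)
    · exact absurd hsm (not_isSmoothVariety_cellClosure_two_one b)
    · exact absurd rfl hij
  · rintro (rfl | rfl | rfl | rfl)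
    · have := hmem 2 0 (by decide)
      rw [cellClosure_two_zero] at this
      exact this (isSmoothVariety_quadric b)
    · exact hproj 0 1 (by decide) _ hb.cellClosure_zero_one
    · exact hproj 1 2 (by decide) _ hb.cellClosure_one_two
    · exact hproj 0 2 (by decide) _ hb.cellClosure_zero_two

theorem exists_plane_ge (hE : Module.finrank ℂ E = 3) {F₁ : Submodule ℂ E}
    (h : Module.finrank ℂ F₁ = 1) : ∃ F₂, IsFlag F₁ F₂ := by
  have : FiniteDimensional ℂ E := FiniteDimensional.of_finrank_pos (by omega)
  obtain ⟨v, -, hv⟩ := SetLike.exists_of_lt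
    (lt_of_le_of_ne le_top (by rintro rfl; rw [finrank_top] at h; omega) : F₁ < ⊤)
  have hv0 : v ≠ 0 := by
    rintro rfl
    exact hv F₁.zero_mem
  have hdisj : F₁ ⊓ Submodule.span ℂ {v} = ⊥ :=
    disjoint_iff.mp (Submodule.disjoint_span_singleton_of_notMem hv)
  have := Submodule.finrank_sup_add_finrank_inf_eq F₁ (Submodule.span ℂ {v})
  rw [hdisj, finrank_bot, finrank_span_singleton hv0, h] at this
  exact ⟨F₁ ⊔ Submodule.span ℂ {v}, h, by omega, le_sup_left⟩

theorem exists_line_le {F₂ : Submodule ℂ E} (h : Module.finrank ℂ F₂ = 2) :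
    ∃ F₁, IsFlag F₁ F₂ := by
  obtain ⟨v, hv, hv0⟩ := Submodule.exists_mem_ne_zero_of_ne_bot (p := F₂)
    (by rintro rfl; rw [finrank_bot] at h; omega)
  exact ⟨Submodule.span ℂ {v}, finrank_span_singleton hv0, h,
    (Submodule.span_singleton_le_iff_mem _ _).mpr hv⟩

theorem exists_smoothOrbitClosure_iff (hE : Module.finrank ℂ E = 3) [FiniteDimensional ℂ E]
    (X : Set (ℙ ℂ (E × Module.Dual ℂ E))) :
    (∃ B : Subgroup (SpecialLinearGroup ℂ E), IsBorel B ∧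
      X ∈ smoothOrbitClosures B (openOrbit E)) ↔
      X = quadric E ∨
      (∃ F₁ : Submodule ℂ E, Module.finrank ℂ F₁ = 1 ∧
        X = projSubspace (F₁.prod F₁.dualAnnihilator)) ∨
      (∃ F₂ : Submodule ℂ E, Module.finrank ℂ F₂ = 2 ∧
        X = projSubspace (F₂.prod F₂.dualAnnihilator)) ∨
      (∃ (V₁ : Submodule ℂ E) (W₁ : Submodule ℂ (Module.Dual ℂ E)),
        Module.finrank ℂ V₁ = 1 ∧ Module.finrank ℂ W₁ = 1 ∧ W₁ ≤ V₁.dualAnnihilator ∧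
        X = projSubspace (V₁.prod W₁)) := by
  have hflag : ∀ {F₁ F₂ : Submodule ℂ E} (hF : IsFlag F₁ F₂),
      X ∈ ({quadric E, projSubspace (F₁.prod F₁.dualAnnihilator),
        projSubspace (F₂.prod F₂.dualAnnihilator),
        projSubspace (F₁.prod F₂.dualAnnihilator)} : Set (Set (ℙ ℂ (E × Module.Dual ℂ E)))) →
      ∃ B : Subgroup (SpecialLinearGroup ℂ E), IsBorel B ∧
        X ∈ smoothOrbitClosures B (openOrbit E) := by
    intro F₁ F₂ hF hX
    refine ⟨_, (isBorel_iff hE).mpr ⟨F₁, F₂, hF, rfl⟩, ?_⟩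
    rwa [hF.smoothOrbitClosures_eq hE]
  constructor
  · rintro ⟨B, hB, hX⟩
    obtain ⟨F₁, F₂, hF, rfl⟩ := (isBorel_iff hE).mp hB
    rw [hF.smoothOrbitClosures_eq hE] at hX
    rcases hX with rfl | rfl | rfl | rfl
    · exact Or.inl rfl
    · exact Or.inr (Or.inl ⟨F₁, hF.1, rfl⟩)
    · exact Or.inr (Or.inr (Or.inl ⟨F₂, hF.2.1, rfl⟩))
    · refine Or.inr (Or.inr (Or.inr ⟨F₁, F₂.dualAnnihilator, hF.1, ?_,
        Submodule.dualAnnihilator_anti hF.2.2, rfl⟩))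
      have := Subspace.finrank_add_finrank_dualAnnihilator_eq F₂
      rw [hE, hF.2.1] at this
      omega
  · rintro (rfl | ⟨F₁, h, rfl⟩ | ⟨F₂, h, rfl⟩ | ⟨V₁, W₁, hV, hW, hle, rfl⟩)
    · let b : Module.Basis (Fin 3) ℂ E := Module.finBasisOfFinrankEq ℂ E hE
      obtain ⟨F₂, hF⟩ := exists_plane_ge hE (finrank_span_singleton (b.ne_zero 0))
      exact hflag hF (Or.inl rfl)
    · obtain ⟨F₂, hF⟩ := exists_plane_ge hE h
      exact hflag hF (Or.inr (Or.inl rfl))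
    · obtain ⟨F₁, hF⟩ := exists_line_le h
      exact hflag hF (Or.inr (Or.inr (Or.inl rfl)))
    -- The flag consists of `V₁` and the common kernel of `W₁`, a plane containing `V₁`; its
    -- annihilator is `W₁` again.
    · have h1 := Subspace.finrank_add_finrank_dualCoannihilator_eq W₁
      have hF : IsFlag V₁ W₁.dualCoannihilator := by
        refine ⟨hV, by omega, ?_⟩
        exact Submodule.le_dualAnnihilator_iff_le_dualCoannihilator.mp hle
      have h2 := hflag hF
      rw [Subspace.dualCoannihilator_dualAnnihilator_eq] at h2
      exact h2 (Or.inr (Or.inr (Or.inr rfl)))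

end OrbitClosures

end HorosphericalQuadric

end

open HorosphericalQuadric in
theorem lemma3p1 {E : Type*} [AddCommGroup E] [Module ℂ E] (hE : Module.finrank ℂ E = 3) :
    (∃! O : Set (ℙ ℂ (E × Module.Dual ℂ E)), IsOpenSLOrbit O) ∧
    ∀ O : Set (ℙ ℂ (E × Module.Dual ℂ E)), IsOpenSLOrbit O →
      -- for a fixed Borel subgroup, `F₁ ≤ F₂` being its invariant flag
      (∀ B : Subgroup (SpecialLinearGroup ℂ E), IsBorel B →
        ∃ F₁ F₂ : Submodule ℂ E,
          Module.finrank ℂ F₁ = 1 ∧ Module.finrank ℂ F₂ = 2 ∧ F₁ ≤ F₂ ∧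
          (∀ g ∈ B, ∀ v ∈ F₁, (g : E ≃ₗ[ℂ] E) v ∈ F₁) ∧ (∀ g ∈ B, ∀ v ∈ F₂, (g : E ≃ₗ[ℂ] E) v ∈ F₂) ∧
          smoothOrbitClosures B O =
            {quadric E,
             projSubspace (F₁.prod F₁.dualAnnihilator),
             projSubspace (F₂.prod F₂.dualAnnihilator),
             projSubspace (F₁.prod F₂.dualAnnihilator)}) ∧
      -- the full list, when the Borel subgroup varies
      (∀ X : Set (ℙ ℂ (E × Module.Dual ℂ E)),
        (∃ B : Subgroup (SpecialLinearGroup ℂ E), IsBorel B ∧ X ∈ smoothOrbitClosures B O) ↔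
          X = quadric E ∨
          (∃ F₁ : Submodule ℂ E, Module.finrank ℂ F₁ = 1 ∧
            X = projSubspace (F₁.prod F₁.dualAnnihilator)) ∨
          (∃ F₂ : Submodule ℂ E, Module.finrank ℂ F₂ = 2 ∧
            X = projSubspace (F₂.prod F₂.dualAnnihilator)) ∨
          (∃ (V₁ : Submodule ℂ E) (W₁ : Submodule ℂ (Module.Dual ℂ E)),
            Module.finrank ℂ V₁ = 1 ∧ Module.finrank ℂ W₁ = 1 ∧ W₁ ≤ V₁.dualAnnihilator ∧
            X = projSubspace (V₁.prod W₁))) := by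
  have : FiniteDimensional ℂ E := FiniteDimensional.of_finrank_pos (by omega)
  refine ⟨⟨openOrbit E, (isOpenSLOrbit_iff hE).mpr rfl, fun O => (isOpenSLOrbit_iff hE).mp⟩, ?_⟩
  intro O hO
  obtain rfl := (isOpenSLOrbit_iff hE).mp hO
  refine ⟨fun B hB => ?_, exists_smoothOrbitClosure_iff hE⟩
  obtain ⟨F₁, F₂, hF, rfl⟩ := (isBorel_iff hE).mp hB
  exact ⟨F₁, F₂, hF.1, hF.2.1, hF.2.2, fun g hg => (mem_flagStabilizer.mp hg).1,
    fun g hg => (mem_flagStabilizer.mp hg).2, hF.smoothOrbitClosures_eq hE⟩
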